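/- **Graphs and graph monoids.** Let $\Gamma=(V,E)$ be a finite undirected graph in which self-loops are allowed, and let $\bar V=\{\bar v\mid v\in V\}$ be a disjoint copy of $V$. The graph monoid $\mathbb{M}_\Gamma$ is the monoid generated by $V\cup\bar V$ subject to the relations $v\bar v=\varepsilon$ for all $v\in V$, and $xy=yx$ for all $x\in\{u,\bar u\}$, $y\in\{v,\bar v\}$ with $\{u,v\}\in E$ (where $u=v$ is allowed). The element represented by a word $w\in(V\cup\bar V)^*$ is written $[w]$. An element $x\in\mathbb{M}_\Gamma$ is right-invertible if $xy=1$ for some $y\in\mathbb{M}_\Gamma$. **Viability games.** A valence game arena over $\Gamma$ consists of a finite set of states $Q=Q_\exists\sqcup Q_\forall$, an initial state $q_{init}\in Q$ and a finite set of transitions $\delta\subseteq Q\times(V\cup\bar V)^*\times Q$, such that every state has an outgoing transition and for all $p,q\in Q$ there is at most one transition from $p$ to $q$. A play from $(q,x)\in Q\times\mathbb{M}_\Gamma$ is an infinite sequence $(q_0,x_0)(q_1,x_1)\cdots$ with $(q_0,x_0)=(q,x)$ such that for every $i$ there is $(q_i,w,q_{i+1})\in\delta$ with $x_{i+1}=x_i[w]$.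 A strategy of the existential player chooses, for every history of states ending in a state of $Q_\exists$, a successor state reachable by a transition. The existential player wins from $(q,x)$ if she has a strategy such that in every play from $(q,x)$ compliant with it, all $x_i$ are right-invertible. **Decision problems.** $\mathsf{FV}(\Gamma)$: given a valence game arena over $\Gamma$ and a word $w\in(V\cup\bar V)^*$, does the existential player win from $(q_{init},[w])$? $\mathsf{UV}(\Gamma)$: given a valence game arena over $\Gamma$, is there a word $w\in(V\cup\bar V)^*$ such that the existential player wins from $(q_{init},[w])$? **The graphs.** All graphs below have the vertices $a,b,c$; $b$ and $c$ are adjacent, $a$ is adjacent to neither $b$ nor $c$, and $a$ may or may not have a self-loop. * Graphs (i): $b$ has no self-loop and $c$ has a self-loop (a pushdown in which each entry carries one $\mathbb{N}$-counter $b$ and one $\mathbb{Z}$-counter $c$). * Graphs (ii): neither $b$ nor $c$ has a self-loop (a pushdown in which each entry carries two VASS counters). **Theorem.** If $\Gamma$ is one of the two graphs (i) or one of the two graphs (ii), then $\mathsf{FV}(\Gamma)$ and $\mathsf{UV}(\Gamma)$ are both undecidable. Both problems are undecidable also if the inputs are restricted to arenas in which every transition is labelled by an element of $V\cup\bar V\cup\{\varepsilon\}$.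 -/

import Mathlib

/-- An undirected graph on `V` in which self-loops are allowed, given by its
set of edges. An edge is an unordered pair `s(u, v)`, and `s(v, v)` is a self-loop at `v`. -/
structure ValenceGraph (V : Type) where
  edges : Set (Sym2 V)

/-- The alphabet `V ∪ V̄`: the pair `(v, true)` is the letter `v`, the pair `(v, false)` is `v̄`. -/
abbrev Letter (V : Type) := V × Bool

namespace ValenceGraph

variable {V : Type}

/-- The defining relations of the graph monoid: `v v̄ = ε` for every vertex `v`, and
`x y = y x` for all `x ∈ {u, ū}`, `y ∈ {v, v̄}` such that `{u, v}` is an edge.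
(For a looped vertex `v` this includes `v̄ v = v v̄`.) -/
inductive Rel (Γ : ValenceGraph V) : FreeMonoid (Letter V) → FreeMonoid (Letter V) → Prop
  | cancel (v : V) : Rel Γ (FreeMonoid.of (v, true) * FreeMonoid.of (v, false)) 1
  | comm (u v : V) (i j : Bool) (h : s(u, v) ∈ Γ.edges) :
      Rel Γ (FreeMonoid.of (u, i) * FreeMonoid.of (v, j))
        (FreeMonoid.of (v, j) * FreeMonoid.of (u, i))

/-- The graph monoid `𝕄_Γ`. -/
abbrev GraphMonoid (Γ : ValenceGraph V) : Type := PresentedMonoid Γ.Rel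

/-- The element `[w]` of the graph monoid represented by the word `w`. -/
def elt (Γ : ValenceGraph V) (w : List (Letter V)) : Γ.GraphMonoid :=
  PresentedMonoid.mk Γ.Rel (FreeMonoid.ofList w)

/-- The set of right-invertible elements of the graph monoid. -/
def RInv (Γ : ValenceGraph V) : Set Γ.GraphMonoid := {x | ∃ y, x * y = 1}

end ValenceGraph

/-- A finite description of a game arena with storage alphabet `V ∪ V̄`. The states are the numbers
`q < owner.length`; the state `q` belongs to the existential player if `owner[q] = true` and to the
universal player if `owner[q] = false`. The entry `(p, w, q)` of `trans` is a transition from `p`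
to `q` labelled by the word `w`. -/
structure Arena (V : Type) where
  owner : List Bool
  trans : List (ℕ × List (Letter V) × ℕ)
  init : ℕ

namespace Arena

variable {V : Type}

/-- An arena is the same thing as the triple of its components. -/
def equivProd (V : Type) :
    Arena V ≃ List Bool × List (ℕ × List (Letter V) × ℕ) × ℕ where
  toFun A := (A.owner, A.trans, A.init)
  invFun t := ⟨t.1, t.2.1, t.2.2⟩
  left_inv _ := rfl
  right_inv _ := rfl

instance [Primcodable V] : Primcodable (Arena V) :=
  Primcodable.ofEquiv _ (equivProd V)

/-- The description is that of a valence game arena: the initial state and all end points of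
transitions are states, every state has an outgoing transition, and between any two states there is
at most one transition. -/
structure IsArena (A : Arena V) : Prop where
  init_lt : A.init < A.owner.length
  trans_lt : ∀ p w q, (p, w, q) ∈ A.trans → p < A.owner.length ∧ q < A.owner.length
  no_dead_end : ∀ p, p < A.owner.length → ∃ w q, (p, w, q) ∈ A.trans
  unique : ∀ p w w' q, (p, w, q) ∈ A.trans → (p, w', q) ∈ A.trans → w = w'

/-- `q` is a state of the existential player. -/
def IsExists (A : Arena V) (q : ℕ) : Prop := A.owner[q]? = some true

/-- Every transition is labelled by a single letter or by the empty word. -/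
def LetterLabelled (A : Arena V) : Prop :=
  ∀ p w q, (p, w, q) ∈ A.trans → w.length ≤ 1

/-- A play: an infinite run of the valence system, as a sequence of configurations. -/
def IsPlay (A : Arena V) (Γ : ValenceGraph V) (π : ℕ → ℕ × Γ.GraphMonoid) : Prop :=
  ∀ i, ∃ w, ((π i).1, w, (π (i + 1)).1) ∈ A.trans ∧ (π (i + 1)).2 = (π i).2 * Γ.elt w

/-- A strategy of the existential player: `σ h q` is the successor chosen in the existential state
`q` after the history `h` of previously visited states. (Other values of `σ` are irrelevant.) -/
def IsStrategy (A : Arena V) (σ : List ℕ → ℕ → ℕ) : Prop :=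
  ∀ h q, A.IsExists q → ∃ w, (q, w, σ h q) ∈ A.trans

/-- The play `π` is compliant with the strategy `σ` of the existential player. -/
def Compliant (A : Arena V) (Γ : ValenceGraph V) (σ : List ℕ → ℕ → ℕ)
    (π : ℕ → ℕ × Γ.GraphMonoid) : Prop :=
  ∀ i, A.IsExists (π i).1 →
    σ ((List.range i).map fun j => (π j).1) (π i).1 = (π (i + 1)).1

/-- The existential player wins the viability game from the configuration `(q, x)`: some strategy
guarantees that all compliant plays from `(q, x)` visit right-invertible configurations only. -/
def ExistsWins (A : Arena V) (Γ : ValenceGraph V) (q : ℕ) (x : Γ.GraphMonoid) : Prop :=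
  ∃ σ : List ℕ → ℕ → ℕ, A.IsStrategy σ ∧
    ∀ π : ℕ → ℕ × Γ.GraphMonoid, A.IsPlay Γ π → π 0 = (q, x) → A.Compliant Γ σ π →
      ∀ i, (π i).2 ∈ Γ.RInv

end Arena

/-- The fixed initial credit problem `FV(Γ)`, with arenas from `K` as inputs, is decidable: an
algorithm determines, given an arena in `K` and a word `w`, whether the existential player wins
from the initial state with credit `[w]`. -/
def FVDecidable {V : Type} [Primcodable V] (Γ : ValenceGraph V) (K : Set (Arena V)) : Prop :=
  ∃ f : Arena V × List (Letter V) → Bool, Computable f ∧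
    ∀ A w, A.IsArena → A ∈ K → (f (A, w) = true ↔ A.ExistsWins Γ A.init (Γ.elt w))

/-- The unknown initial credit problem `UV(Γ)`, with arenas from `K` as inputs, is decidable: an
algorithm determines, given an arena in `K`, whether there is a word `w` such that the existential
player wins from the initial state with credit `[w]`. -/
def UVDecidable {V : Type} [Primcodable V] (Γ : ValenceGraph V) (K : Set (Arena V)) : Prop :=
  ∃ f : Arena V → Bool, Computable f ∧
    ∀ A, A.IsArena → A ∈ K →
      (f A = true ↔ ∃ w : List (Letter V), A.ExistsWins Γ A.init (Γ.elt w))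

/-- The graphs (i), on the vertices `a = 0`, `b = 1`, `c = 2`: `b` and `c` are adjacent, `c` has a
self-loop, `b` has none, `a` is adjacent to no other vertex, and `a` has a self-loop or not. -/
def graphI (aLoop : Bool) : ValenceGraph (Fin 3) where
  edges := {s(1, 2), s(2, 2)} ∪ {e | aLoop = true ∧ e = s(0, 0)}

/-- The graphs (ii), on the vertices `a = 0`, `b = 1`, `c = 2`: `b` and `c` are adjacent and have no
self-loops, `a` is adjacent to no other vertex, and `a` has a self-loop or not. -/
def graphII (aLoop : Bool) : ValenceGraph (Fin 3) where
  edges := {s(1, 2)} ∪ {e | aLoop = true ∧ e = s(0, 0)}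

/-!
The game is played on a two-counter machine. The counter values `x` and `y` are stored in the top
entry of the stack as `x + y` letters `b` and `y` letters `c`, above an entry that contains at least
one letter `b`. The existential player executes the instructions. Whenever she claims that a counter
is zero, or decrements a counter, the universal player may stop the execution and have her claim
tested: she has to empty the counters, without access to the one she has claimed to be zero, and
then apply `ā` and `b̄`. This keeps the credit right-invertible if and only if the top entry has
been emptied. Every operation on either counter changes the number of letters `b`, so the test
cannot be prolonged forever although `c` may be a `ℤ`-counter. This is why the `ℕ`-counter `b`
stores the sum. Hence the existential player wins if and only if the machine does not halt. The
arena begins with a path labelled by `b`, `a` and the input, so that a fresh entry lies above a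
nonempty one whatever the initial credit was; therefore the problems with a given and with an
unknown credit are equally hard.

That an honest credit is right-invertible is plain, as it is a product of the letters `a`, `b`, `c`.
Failed tests are recognised by a partial action of the graph monoid on stacks
(`ValenceGraph.actHom`), in which a right-invertible element is defined everywhere. One
action serves all four graphs: it factors through the quotient in which `a` becomes an involution
and `c` invertible. Winning is treated through sets of configurations in which the existential
player can stay (`Viable`, `Arena.existsWins_iff_viable`); `CounterGame.isViable_honest` and
`CounterGame.not_halts_of_viable` are the two directions of the reduction.

For the undecidable halting problem, primitive recursive functions are compiled to structured
programs over registers (`Prog.computes_of_primrec'`), and registers are reduced to two counters by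
Gödel encoding (`Prog.Run.toTwo`). A search for a halting time of a partial recursive function,
whose bounded evaluation is primitive recursive, then gives a single program whose halting problem
on the inputs `2 ^ n` is undecidable (`Prog.exists_universal_prog`). As the program is fixed, only
the initial path of the arena depends on the instance, and the reduction is visibly computable.
-/

/-! ### Counter programs -/

/-- Structured programs over counters indexed by `ι`, each of which returns a Boolean. `inc i`
increments the counter `i` and returns `true`. `dec i` decrements it and returns `true` if it is
positive, and changes nothing and returns `false` otherwise. `ret b` returns `b`. `ite p q r` runs
`p`, then `q` or `r` according to the result of `p`. `rep p` runs `p` until it returns `false`. -/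
inductive Prog (ι : Type)
  | inc (i : ι)
  | dec (i : ι)
  | ret (b : Bool)
  | ite (p q r : Prog ι)
  | rep (p : Prog ι)

namespace Prog

variable {ι : Type} [DecidableEq ι]

/-- Big-step semantics: `Run p s s' b` says that `p`, started with the counter values `s`,
terminates with the values `s'` and returns `b`. -/
inductive Run : Prog ι → (ι → ℕ) → (ι → ℕ) → Bool → Prop
  | inc (i s) : Run (inc i) s (Function.update s i (s i + 1)) true
  | decZero (i s) : s i = 0 → Run (dec i) s s false
  | decSucc (i s k) : s i = k + 1 → Run (dec i) s (Function.update s i k) true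
  | ret (b s) : Run (ret b) s s b
  | iteTrue (p q r s s' s'' b) :
      Run p s s' true → Run q s' s'' b → Run (ite p q r) s s'' b
  | iteFalse (p q r s s' s'' b) :
      Run p s s' false → Run r s' s'' b → Run (ite p q r) s s'' b
  | repTrue (p s s' s'' b) : Run p s s' true → Run (rep p) s' s'' b → Run (rep p) s s'' b
  | repFalse (p s s') : Run p s s' false → Run (rep p) s s' false

/-- `Does p s s'`: the program `p` turns the counter values `s` into `s'`, whatever it returns. -/
def Does (p : Prog ι) (s s' : ι → ℕ) : Prop := ∃ b, Run p s s' b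

/-- Run `p`, then `q`. -/
def seq (p q : Prog ι) : Prog ι := ite p q q

/-- While the counter `i` is positive, decrement it and run `p`. -/
def loop (i : ι) (p : Prog ι) : Prog ι :=
  rep (ite (dec i) (seq p (ret true)) (ret false))

theorem run_seq {p q : Prog ι} {s s' s'' : ι → ℕ} {b : Bool} (hp : Does p s s')
    (hq : Run q s' s'' b) : Run (seq p q) s s'' b := by
  obtain ⟨_ | _, hp⟩ := hp
  · exact .iteFalse _ _ _ _ _ _ _ hp hq
  · exact .iteTrue _ _ _ _ _ _ _ hp hq

theorem Does.seq {p q : Prog ι} {s s' s'' : ι → ℕ} (hp : Does p s s') (hq : Does q s' s'') :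
    Does (seq p q) s s'' := hq.imp fun _ hq => run_seq hp hq

theorem Does.of_eq {p : Prog ι} {s s' s'' : ι → ℕ} (hp : Does p s s') (h : s' = s'') :
    Does p s s'' := h ▸ hp

theorem does_inc (i : ι) (s : ι → ℕ) : Does (inc i) s (Function.update s i (s i + 1)) :=
  ⟨_, .inc i s⟩

theorem does_ret (b : Bool) (s : ι → ℕ) : Does (ret b) s s := ⟨_, .ret b s⟩

theorem run_ite_dec_zero {i : ι} {q r : Prog ι} {s s' : ι → ℕ} {b : Bool} (h : s i = 0)
    (hr : Run r s s' b) : Run (ite (dec i) q r) s s' b :=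
  .iteFalse _ _ _ _ _ _ _ (.decZero _ _ h) hr

theorem run_ite_dec_succ {i : ι} {q r : Prog ι} {s s' : ι → ℕ} {b : Bool} {k : ℕ}
    (h : s i = k + 1) (hq : Run q (Function.update s i k) s' b) :
    Run (ite (dec i) q r) s s' b :=
  .iteTrue _ _ _ _ _ _ _ (.decSucc _ _ _ h) hq

/-- A loop is executed along a family `f` of counter values, where `f k` is reached when `k`
iterations remain. -/
theorem does_loop {i : ι} {p : Prog ι} (f : ℕ → ι → ℕ) (n : ℕ) (hf : ∀ k ≤ n, f k i = k)
    (hp : ∀ k < n, Does p (Function.update (f (k + 1)) i k) (f k)) :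
    Does (loop i p) (f n) (f 0) := by
  refine ⟨false, ?_⟩
  induction n with
  | zero => exact .repFalse _ _ _ (run_ite_dec_zero (hf 0 le_rfl) (.ret _ _))
  | succ n ih =>
    exact .repTrue _ _ _ _ _
      (run_ite_dec_succ (hf (n + 1) le_rfl) (run_seq (hp n n.lt_succ_self) (.ret _ _)))
      (ih (fun k hk => hf k (by omega)) fun k hk => hp k (by omega))

/-! ### Primitive recursive functions on registers -/

/-- Set the counter `i` to zero. -/
def clear (i : ι) : Prog ι := loop i (ret true)

theorem does_clear (i : ι) (s : ι → ℕ) : Does (clear i) s (Function.update s i 0) := by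
  have := does_loop (i := i) (p := ret true) (fun k => Function.update s i k) (s i)
    (by simp) (by simpa using fun k _ => does_ret _ _)
  simpa [clear] using this

/-- Move the content of the counter `i` to the counter `j`. -/
def move (i j : ι) : Prog ι := loop i (inc j)

theorem does_move {i j : ι} (hij : i ≠ j) (s : ι → ℕ) :
    Does (move i j) s (Function.update (Function.update s j (s j + s i)) i 0) := by
  have := does_loop (i := i) (p := inc j)
    (fun k => Function.update (Function.update s j (s j + (s i - k))) i k) (s i)
    (by simp) (fun k hk => (does_inc _ _).of_eq (by
      ext x
      simp only [Function.update_apply]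
      split_ifs <;> first | omega | simp_all))
  simpa [move] using this

/-- Add the content of the register `i` to the register `j`, using the empty register `k`. -/
def copy (i j k : ι) : Prog ι := seq (loop i (seq (inc j) (inc k))) (move k i)

theorem does_copy {i j k : ι} (hij : i ≠ j) (hik : i ≠ k) (hjk : j ≠ k) (s : ι → ℕ)
    (hs : s k = 0) : Does (copy i j k) s (Function.update s j (s j + s i)) := by
  have := does_loop (i := i) (p := seq (inc j) (inc k))
    (fun m => Function.update (Function.update (Function.update s j (s j + (s i - m)))
      k (s i - m)) i m) (s i)
    (by simp) (fun m hm => ((does_inc _ _).seq (does_inc _ _)).of_eq (by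
      ext x
      simp only [Function.update_apply]
      split_ifs <;> first | omega | simp_all))
  have h : Function.update (Function.update (Function.update s j (s j + (s i - s i)))
      k (s i - s i)) i (s i) = s := by
    ext x
    simp only [Function.update_apply]
    split_ifs <;> first | omega | simp_all
  rw [h] at this
  refine (this.seq (does_move hik.symm _)).of_eq ?_
  ext x
  simp only [Function.update_apply]
  split_ifs <;> first | omega | simp_all

/-- `Computes f`: for all input registers `inp` and every output register `out` among the registers
below `k`, with `out` not an input, there is a program that adds the value of `f` at the inputs to
the register `out` and otherwise changes nothing, provided that all registers from `k` on are
empty. -/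
def Computes {n : ℕ} (f : List.Vector ℕ n → ℕ) : Prop :=
  ∀ (inp : Fin n → ℕ) (out k : ℕ), (∀ i, inp i < k) → out < k → (∀ i, inp i ≠ out) →
    ∃ p : Prog ℕ, ∀ s : ℕ → ℕ, (∀ j, k ≤ j → s j = 0) →
      Does p s (Function.update s out (s out + f (List.Vector.ofFn fun i => s (inp i))))

theorem computes_get {n : ℕ} (i : Fin n) : Computes fun v => v.get i := by
  intro inp out k hi ho hne
  refine ⟨copy (inp i) out k, fun s hs => ?_⟩
  simpa using does_copy (hne i) (hi i).ne ho.ne s (hs k le_rfl)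

theorem computes_succ : Computes (n := 1) fun v => v.head.succ := by
  intro inp out k hi ho hne
  refine ⟨seq (copy (inp 0) out k) (inc out), fun s hs => ?_⟩
  refine ((does_copy (hne 0) (hi 0).ne ho.ne s (hs k le_rfl)).seq (does_inc _ _)).of_eq ?_
  ext x
  simp only [Function.update_apply]
  split_ifs <;> simp [Nat.add_assoc]

/-- Registers `k, …, k + m - 1` are cleared. -/
theorem exists_does_clear_range (k m : ℕ) : ∃ p : Prog ℕ, ∀ s : ℕ → ℕ,
    Does p s fun j => if k ≤ j ∧ j < k + m then 0 else s j := by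
  induction m with
  | zero =>
    refine ⟨ret true, fun s => (does_ret true s).of_eq ?_⟩
    ext j
    simp
  | succ m ih =>
    obtain ⟨p, hp⟩ := ih
    refine ⟨seq p (clear (k + m)), fun s => ((hp s).seq (does_clear _ _)).of_eq ?_⟩
    ext j
    simp only [Function.update_apply]
    split_ifs <;> omega

/-- The values of finitely many computable functions at the same inputs are written to the
registers `k, k + 1, …`. -/
theorem exists_does_tuple {n : ℕ} (inp : Fin n → ℕ) (k : ℕ) (hi : ∀ i, inp i < k) (m : ℕ)
    (g : Fin m → List.Vector ℕ n → ℕ) (hg : ∀ i, Computes (g i)) :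
    ∃ p : Prog ℕ, ∀ s : ℕ → ℕ, (∀ j, k ≤ j → s j = 0) →
      Does p s fun j => if h : k ≤ j ∧ j < k + m then
        g ⟨j - k, by omega⟩ (List.Vector.ofFn fun i => s (inp i)) else s j := by
  induction m with
  | zero =>
    refine ⟨ret true, fun s _ => (does_ret true s).of_eq ?_⟩
    ext j
    simp
  | succ m ih =>
    obtain ⟨p, hp⟩ := ih (fun i => g i.castSucc) fun i => hg _
    obtain ⟨q, hq⟩ := hg (Fin.last m) inp (k + m) (k + m + 1) (fun i => by have := hi i; omega)
      (by omega) (fun i => by have := hi i; omega)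
    refine ⟨seq p q, fun s hs => ((hp s hs).seq (hq _ fun j hj => ?_)).of_eq ?_⟩
    · rw [dif_neg (by omega), hs j (by omega)]
    · ext j
      have hin : ∀ i, ¬(k ≤ inp i ∧ inp i < k + m) := fun i => by have := hi i; omega
      rcases lt_trichotomy j (k + m) with h | rfl | h
      · rw [Function.update_of_ne h.ne]
        by_cases h' : k ≤ j
        · rw [dif_pos ⟨h', h⟩, dif_pos ⟨h', by omega⟩]
          rfl
        · rw [dif_neg (by omega), dif_neg (by omega)]
      · simp [hin, hs (k + m) (by omega), Fin.last]
      · rw [Function.update_of_ne h.ne', dif_neg (by omega), dif_neg (by omega)]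

theorem Computes.comp {m n : ℕ} {f : List.Vector ℕ n → ℕ} (g : Fin n → List.Vector ℕ m → ℕ)
    (hf : Computes f) (hg : ∀ i, Computes (g i)) :
    Computes fun v => f (List.Vector.ofFn fun i => g i v) := by
  intro inp out k hi ho hne
  obtain ⟨p, hp⟩ := exists_does_tuple inp k hi n g hg
  obtain ⟨q, hq⟩ := hf (fun i => k + i) out (k + n) (fun i => by omega) (by omega)
    (fun i => by omega)
  obtain ⟨c, hc⟩ := exists_does_clear_range k n
  refine ⟨seq p (seq q c), fun s hs =>
    ((hp s hs).seq ((hq _ fun j hj => ?_).seq (hc _))).of_eq ?_⟩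
  · rw [dif_neg (by omega), hs j (by omega)]
  · ext j
    simp only [Function.update_apply]
    by_cases h : k ≤ j ∧ j < k + n
    · simp [h, hs j h.1, show j ≠ out by omega]
    · by_cases h' : j = out
      · subst h'
        simp [h]
      · simp [h, h']

theorem Computes.prec {n : ℕ} {f : List.Vector ℕ n → ℕ} {g : List.Vector ℕ (n + 2) → ℕ}
    (hf : Computes f) (hg : Computes g) :
    Computes fun v : List.Vector ℕ (n + 1) =>
      v.head.rec (f v.tail) fun y IH => g (y ::ᵥ IH ::ᵥ v.tail) := by
  intro inp out k hi ho hne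
  -- The registers are used as follows: `k` counts the finished iterations, `k + 1` holds the
  -- current value, `k + 2` counts the remaining iterations and `k + 3` receives the next value.
  obtain ⟨p, hp⟩ := hf (fun i => inp i.succ) (k + 1) (k + 4)
    (fun i => by have := hi i.succ; omega) (by omega) (fun i => by have := hi i.succ; omega)
  obtain ⟨q, hq⟩ := hg (Fin.cons k (Fin.cons (k + 1) fun i => inp i.succ)) (k + 3) (k + 4)
    (fun i => by
      refine Fin.cases (by simp) (fun i => Fin.cases (by simp) (fun i => ?_) i) i
      have := hi i.succ; simp only [Fin.cons_succ]; omega) (by omega)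
    (fun i => by
      refine Fin.cases (by simp) (fun i => Fin.cases (by simp) (fun i => ?_) i) i
      have := hi i.succ; simp only [Fin.cons_succ]; omega)
  refine ⟨seq (seq (copy (inp 0) (k + 2) (k + 4)) p) (seq (loop (k + 2)
    (seq q (seq (clear (k + 1)) (seq (move (k + 3) (k + 1)) (inc k)))))
    (seq (move (k + 1) out) (clear k))), fun s hs => ?_⟩
  set v : List.Vector ℕ n := List.Vector.ofFn fun i => s (inp i.succ) with hv
  set F : ℕ → ℕ := fun m => m.rec (f v) fun y IH => g (y ::ᵥ IH ::ᵥ v) with hF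
  set N := s (inp 0) with hN
  -- the registers when `m` iterations remain
  set st : ℕ → ℕ → ℕ := fun m => Function.update (Function.update (Function.update s k (N - m))
    (k + 1) (F (N - m))) (k + 2) m with hst
  have h0 := hi 0
  have hin : ∀ i, inp i ≠ k ∧ inp i ≠ k + 1 ∧ inp i ≠ k + 2 ∧ inp i ≠ k + 3 := fun i => by
    have := hi i; omega
  have h1 : Does (seq (copy (inp 0) (k + 2) (k + 4)) p) s (st N) := by
    refine ((does_copy (by omega) (by omega) (by omega) s (hs _ (by omega))).seq
      (hp _ fun j hj => ?_)).of_eq ?_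
    · rw [Function.update_of_ne (by omega), hs j (by omega)]
    · have hv' : (List.Vector.ofFn fun i : Fin n =>
          Function.update s (k + 2) (s (k + 2) + s (inp 0)) (inp i.succ)) = v := by
        simp [hin, hv]
      rw [hv']
      ext j
      have := hs k le_rfl
      have := hs (k + 1) (by omega)
      have := hs (k + 2) (by omega)
      simp only [hst, Function.update_apply]
      split_ifs <;> first | omega | simp_all
  have h2 : Does (loop (k + 2) (seq q (seq (clear (k + 1)) (seq (move (k + 3) (k + 1)) (inc k)))))
      (st N) (st 0) := by
    refine does_loop st N (by simp [hst]) fun m hm => ?_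
    refine ((hq _ fun j hj => ?_).seq ((does_clear _ _).seq
      ((does_move (by omega) _).seq (does_inc _ _)))).of_eq ?_
    · simp only [hst]
      rw [Function.update_of_ne (by omega), Function.update_of_ne (by omega),
        Function.update_of_ne (by omega), Function.update_of_ne (by omega), hs j (by omega)]
    · have hv' : (List.Vector.ofFn fun i : Fin (n + 2) =>
          Function.update (st (m + 1)) (k + 2) m
            ((Fin.cons k (Fin.cons (k + 1) fun i => inp i.succ) : Fin (n + 2) → ℕ) i)) =
          (N - (m + 1)) ::ᵥ F (N - (m + 1)) ::ᵥ v := by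
        rw [List.Vector.ofFn, List.Vector.ofFn]
        simp [hst, hin, hv]
      rw [hv']
      have hF' : g ((N - (m + 1)) ::ᵥ F (N - (m + 1)) ::ᵥ v) = F (N - m) := by
        rw [show N - m = (N - (m + 1)) + 1 by omega]
      rw [hF']
      have := hs (k + 3) (by omega)
      ext j
      simp only [hst, Function.update_apply]
      split_ifs <;> first | omega | simp_all
  have h3 : Does (seq (move (k + 1) out) (clear k)) (st 0)
      (Function.update s out (s out + F N)) := by
    refine ((does_move (by omega) _).seq (does_clear _ _)).of_eq ?_
    have := hs k le_rfl
    have := hs (k + 1) (by omega)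
    have := hs (k + 2) (by omega)
    ext j
    simp only [hst, Function.update_apply]
    split_ifs <;> first | omega | simp_all
  refine (h1.seq (h2.seq h3)).of_eq ?_
  have : (List.Vector.ofFn fun i => s (inp i)) = N ::ᵥ v := rfl
  rw [this]
  rfl

/-- Every primitive recursive function is computed by a program. -/
theorem computes_of_primrec' {n : ℕ} {f : List.Vector ℕ n → ℕ} (hf : Nat.Primrec' f) :
    Computes f := by
  induction hf with
  | zero => exact fun _ out _ _ _ _ => ⟨ret true, fun s _ => (does_ret true s).of_eq (by simp)⟩
  | succ => exact computes_succ
  | get i => exact computes_get i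
  | comp g _ _ hf hg => exact hf.comp g hg
  | prec _ _ hf hg => exact hf.prec hg

end Prog

namespace Prog

/-! ### Two counters suffice -/

/-- The counter values `x` (at `false`) and `y` (at `true`). -/
def two (x y : ℕ) : Bool → ℕ := fun b => cond b y x

@[simp] theorem two_false (x y : ℕ) : two x y false = x := rfl

@[simp] theorem two_true (x y : ℕ) : two x y true = y := rfl

@[simp] theorem update_two_false (x y z : ℕ) : Function.update (two x y) false z = two z y := by
  ext (_ | _) <;> simp

@[simp] theorem update_two_true (x y z : ℕ) : Function.update (two x y) true z = two x z := by
  ext (_ | _) <;> simp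

theorem does_incX (x y : ℕ) : Does (inc false) (two x y) (two (x + 1) y) :=
  (does_inc _ _).of_eq (by simp)

theorem does_incY (x y : ℕ) : Does (inc true) (two x y) (two x (y + 1)) :=
  (does_inc _ _).of_eq (by simp)

/-- Increment the counter `i` by `n`. -/
def incN (i : Bool) : ℕ → Prog Bool
  | 0 => ret true
  | n + 1 => seq (inc i) (incN i n)

theorem does_incX_iter (n x y : ℕ) : Does (incN false n) (two x y) (two (x + n) y) := by
  induction n generalizing x with
  | zero => exact does_ret _ _
  | succ n ih => exact ((does_incX x y).seq (ih (x + 1))).of_eq (by congr 1; omega)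

theorem does_incY_iter (n x y : ℕ) : Does (incN true n) (two x y) (two x (y + n)) := by
  induction n generalizing y with
  | zero => exact does_ret _ _
  | succ n ih => exact ((does_incY x y).seq (ih (y + 1))).of_eq (by congr 1; omega)

/-- Multiply the first counter by `p`; the second counter is empty before and afterwards. -/
def mulBy (p : ℕ) : Prog Bool := seq (loop false (incN true p)) (move true false)

theorem does_moveYX (x y : ℕ) : Does (move true false) (two x y) (two (x + y) 0) :=
  (does_move (by simp) _).of_eq (by simp)

theorem does_mulBy (p x : ℕ) : Does (mulBy p) (two x 0) (two (x * p) 0) := by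
  have := does_loop (i := false) (p := incN true p) (fun k => two k ((x - k) * p)) x (by simp)
    (fun k hk => by
      simp only [update_two_false]
      refine (does_incY_iter p k _).of_eq ?_
      rw [show x - k = x - (k + 1) + 1 by omega, Nat.succ_mul])
  simp only [Nat.sub_self, Nat.zero_mul, Nat.sub_zero] at this
  exact (this.seq (does_moveYX 0 _)).of_eq (by simp)

/-- Subtract `p` from the first counter and return `true` if this is possible; otherwise change
nothing and return `false`. -/
def trySub : ℕ → Prog Bool
  | 0 => ret true
  | p + 1 => ite (dec false) (ite (trySub p) (ret true) (seq (inc false) (ret false))) (ret false)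

theorem run_trySub_of_le (p x y : ℕ) (h : p ≤ x) :
    Run (trySub p) (two x y) (two (x - p) y) true := by
  induction p generalizing x with
  | zero => exact .ret _ _
  | succ p ih =>
    refine run_ite_dec_succ (k := x - 1) (by simp only [two_false]; omega) ?_
    rw [update_two_false, show x - (p + 1) = x - 1 - p by omega]
    exact .iteTrue _ _ _ _ _ _ _ (ih (x - 1) (by omega)) (.ret _ _)

theorem run_trySub_of_lt (p x y : ℕ) (h : x < p) :
    Run (trySub p) (two x y) (two x y) false := by
  induction p generalizing x with
  | zero => omega
  | succ p ih =>
    rcases x with _ | x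
    · exact run_ite_dec_zero rfl (.ret _ _)
    · refine run_ite_dec_succ (k := x) rfl ?_
      rw [update_two_false]
      exact .iteFalse _ _ _ _ _ _ _ (ih x (by omega))
        (run_seq (does_incX x y) (.ret _ _))

/-- Divide the first counter by `p`: the remainder stays in the first counter and the quotient
is added to the second one. -/
def divMod (p : ℕ) : Prog Bool := rep (ite (trySub p) (inc true) (ret false))

theorem does_divMod (p q r y : ℕ) (hr : r < p) :
    Does (divMod p) (two (p * q + r) y) (two r (y + q)) := by
  refine ⟨false, ?_⟩
  induction q generalizing y with
  | zero =>
    rw [Nat.mul_zero, Nat.zero_add]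
    exact .repFalse _ _ _ (.iteFalse _ _ _ _ _ _ _ (run_trySub_of_lt p r y hr) (.ret _ _))
  | succ q ih =>
    rw [show y + (q + 1) = (y + 1) + q by omega]
    refine .repTrue _ _ _ _ _ (.iteTrue _ _ _ _ _ _ _ (run_trySub_of_le p _ y ?_) ?_) (ih (y + 1))
    · rw [Nat.mul_succ]; omega
    · convert Run.inc true (two (p * q + r) y) using 1
      · rw [Nat.mul_succ]; congr 1; omega
      · simp

/-- If the first counter is divisible by `p`, then divide it by `p` and return `true`. Otherwise
return `false` and change nothing. The second counter is empty before and afterwards. -/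
def divBy (p : ℕ) : Prog Bool :=
  seq (divMod p) (ite (dec false)
    (seq (inc false) (seq (loop true (incN false p)) (ret false)))
    (seq (move true false) (ret true)))

theorem run_divBy_of_dvd {p : ℕ} (hp : 0 < p) (x : ℕ) :
    Run (divBy p) (two (p * x) 0) (two x 0) true := by
  have h := does_divMod p x 0 0 hp
  rw [Nat.add_zero, Nat.zero_add] at h
  refine run_seq h (run_ite_dec_zero rfl (run_seq (does_moveYX 0 x) ?_))
  rw [Nat.zero_add]
  exact .ret _ _

theorem run_divBy_of_not_dvd {p : ℕ} (hp : 0 < p) (x : ℕ) (hx : ¬p ∣ x) :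
    Run (divBy p) (two x 0) (two x 0) false := by
  have h := does_divMod p (x / p) (x % p) 0 (Nat.mod_lt _ hp)
  rw [Nat.div_add_mod, Nat.zero_add] at h
  have hpos : 0 < x % p := Nat.pos_of_ne_zero fun h0 => hx (Nat.dvd_of_mod_eq_zero h0)
  refine run_seq h (run_ite_dec_succ (k := x % p - 1) (by simp only [two_false]; omega) ?_)
  rw [update_two_false]
  have h1 := does_incX (x % p - 1) (x / p)
  rw [Nat.sub_add_cancel hpos] at h1
  have h2 := does_loop (i := true) (p := incN false p) (fun k => two (x - p * k) k) (x / p)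
    (by simp) (fun k hk => by
      simp only [update_two_true]
      refine (does_incX_iter p _ k).of_eq ?_
      have : p * (k + 1) ≤ x := (Nat.mul_le_mul_left p hk).trans (Nat.mul_div_le x p)
      rw [Nat.mul_succ] at this ⊢
      congr 1
      omega)
  rw [show x - p * (x / p) = x % p by have := Nat.div_add_mod x p; omega] at h2
  simp only [Nat.mul_zero, Nat.sub_zero] at h2
  exact run_seq h1 (run_seq h2 (.ret _ _))

/-- Gödel encoding of registers: `Godel s x` says that the exponent of the `i`-th prime number in
`x` is the content `s i` of the `i`-th register. -/
def Godel (s : ℕ → ℕ) (x : ℕ) : Prop :=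
  x ≠ 0 ∧ ∀ i, x.factorization (Nat.nth Nat.Prime i) = s i

theorem Godel.mul {s : ℕ → ℕ} {x : ℕ} (h : Godel s x) (i : ℕ) :
    Godel (Function.update s i (s i + 1)) (x * Nat.nth Nat.Prime i) := by
  have hp := Nat.prime_nth_prime i
  refine ⟨mul_ne_zero h.1 hp.ne_zero, fun j => ?_⟩
  rw [Nat.factorization_mul h.1 hp.ne_zero, Finsupp.add_apply, h.2 j, hp.factorization,
    Finsupp.single_apply, Function.update_apply]
  by_cases hij : j = i
  · simp [hij]
  · have : Nat.nth Nat.Prime i ≠ Nat.nth Nat.Prime j :=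
      fun e => hij (Nat.nth_injective Nat.infinite_setOfPred_prime e.symm)
    simp [hij, this]

theorem Godel.dvd_iff {s : ℕ → ℕ} {x : ℕ} (h : Godel s x) (i : ℕ) :
    Nat.nth Nat.Prime i ∣ x ↔ s i ≠ 0 := by
  rw [← h.2 i, (Nat.prime_nth_prime i).dvd_iff_one_le_factorization h.1]
  omega

theorem Godel.div {s : ℕ → ℕ} {x : ℕ} {i k : ℕ} (h : Godel s (Nat.nth Nat.Prime i * x))
    (hk : s i = k + 1) : Godel (Function.update s i k) x := by
  have hx : x ≠ 0 := right_ne_zero_of_mul h.1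
  have hp := Nat.prime_nth_prime i
  refine ⟨hx, fun j => ?_⟩
  have := h.2 j
  rw [Nat.factorization_mul hp.ne_zero hx, Finsupp.add_apply, hp.factorization,
    Finsupp.single_apply] at this
  rw [Function.update_apply]
  by_cases hij : j = i
  · subst hij
    simp only [if_true] at this ⊢
    omega
  · have hne : Nat.nth Nat.Prime i ≠ Nat.nth Nat.Prime j :=
      fun e => hij (Nat.nth_injective Nat.infinite_setOfPred_prime e.symm)
    simpa [hij, hne] using this

/-- Replace every access to the register `i` by a multiplication or division by the `i`-th prime
number. -/
noncomputable def toTwo : Prog ℕ → Prog Bool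
  | inc i => seq (mulBy (Nat.nth Nat.Prime i)) (ret true)
  | dec i => divBy (Nat.nth Nat.Prime i)
  | ret b => ret b
  | ite p q r => ite (toTwo p) (toTwo q) (toTwo r)
  | rep p => rep (toTwo p)

/-- The two-counter program simulates the register program on Gödel numbers. -/
theorem Run.toTwo {p : Prog ℕ} {s s' : ℕ → ℕ} {b : Bool} (h : Run p s s' b) {x : ℕ}
    (hx : Godel s x) : ∃ x', Godel s' x' ∧ Run (toTwo p) (two x 0) (two x' 0) b := by
  induction h generalizing x with
  | inc i s => exact ⟨_, hx.mul i, run_seq (does_mulBy _ _) (.ret _ _)⟩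
  | decZero i s h0 =>
    exact ⟨x, hx, run_divBy_of_not_dvd (Nat.prime_nth_prime i).pos x fun hd =>
      (hx.dvd_iff i).1 hd h0⟩
  | decSucc i s k hk =>
    obtain ⟨z, rfl⟩ := (hx.dvd_iff i).2 (by omega)
    exact ⟨z, hx.div hk, run_divBy_of_dvd (Nat.prime_nth_prime i).pos z⟩
  | ret b s => exact ⟨x, hx, .ret _ _⟩
  | iteTrue p q r s s' s'' b _ _ ih ih' =>
    obtain ⟨x', hx', h'⟩ := ih hx
    obtain ⟨x'', hx'', h''⟩ := ih' hx'
    exact ⟨x'', hx'', .iteTrue _ _ _ _ _ _ _ h' h''⟩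
  | iteFalse p q r s s' s'' b _ _ ih ih' =>
    obtain ⟨x', hx', h'⟩ := ih hx
    obtain ⟨x'', hx'', h''⟩ := ih' hx'
    exact ⟨x'', hx'', .iteFalse _ _ _ _ _ _ _ h' h''⟩
  | repTrue p s s' s'' b _ _ ih ih' =>
    obtain ⟨x', hx', h'⟩ := ih hx
    obtain ⟨x'', hx'', h''⟩ := ih' hx'
    exact ⟨x'', hx'', .repTrue _ _ _ _ _ h' h''⟩
  | repFalse p s s' _ ih =>
    obtain ⟨x', hx', h'⟩ := ih hx
    exact ⟨x', hx', .repFalse _ _ _ h'⟩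

/-! ### Executing a program step by step -/

/-- A frame of the call stack: what remains to be done once the current subprogram has returned
a Boolean. -/
inductive Frame (ι : Type)
  | ite (q r : Prog ι)
  | rep (p : Prog ι)

/-- A control point: the program that is being executed, and the call stack. -/
abbrev Ctl (ι : Type) := Prog ι × List (Frame ι)

/-- The instructions of a counter machine with control points in `C`. -/
inductive Instr (ι C : Type)
  | halt
  | nop (c : C)
  | inc (i : ι) (c : C)
  | dec (i : ι) (c₀ c₁ : C)

/-- The instruction to be executed at a control point. -/
def instr {ι : Type} : Ctl ι → Instr ι (Ctl ι)
  | (ret _, []) => .halt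
  | (ret true, .ite q _ :: K) => .nop (q, K)
  | (ret false, .ite _ r :: K) => .nop (r, K)
  | (ret true, .rep p :: K) => .nop (p, .rep p :: K)
  | (ret false, .rep _ :: K) => .nop (ret false, K)
  | (inc i, K) => .inc i (ret true, K)
  | (dec i, K) => .dec i (ret false, K) (ret true, K)
  | (ite p q r, K) => .nop (p, .ite q r :: K)
  | (rep p, K) => .nop (p, .rep p :: K)

/-- The control points to which an instruction may lead. -/
def Instr.targets {ι C : Type} : Instr ι C → List C
  | .halt => []
  | .nop c => [c]
  | .inc _ c => [c]
  | .dec _ c₀ c₁ => [c₀, c₁]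

/-- The control points visited by `p` when it is executed with the call stack `K`, including those
at which it has returned. -/
def points {ι : Type} : Prog ι → List (Frame ι) → Set (Ctl ι)
  | ite p q r, K =>
    {(ite p q r, K)} ∪ (points p (.ite q r :: K) ∪ (points q K ∪ points r K))
  | rep p, K => {(rep p, K), (ret true, K), (ret false, K)} ∪ points p (.rep p :: K)
  | inc i, K => {(inc i, K), (ret true, K), (ret false, K)}
  | dec i, K => {(dec i, K), (ret true, K), (ret false, K)}
  | ret b, K => {(ret b, K), (ret true, K), (ret false, K)}

theorem finite_points {ι : Type} (p : Prog ι) (K : List (Frame ι)) : (points p K).Finite := by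
  induction p generalizing K with
  | ite p q r hp hq hr =>
    exact (Set.finite_singleton _).union ((hp _).union ((hq _).union (hr _)))
  | rep p hp => exact Set.Finite.union (by simp) (hp _)
  | _ => simp [points]

theorem self_mem_points {ι : Type} (p : Prog ι) (K : List (Frame ι)) : (p, K) ∈ points p K := by
  cases p <;> simp [points]

/-- The control points of a subprogram are only left by returning from it. -/
theorem targets_mem_points {ι : Type} (p : Prog ι) (K : List (Frame ι)) {c : Ctl ι}
    (hc : c ∈ points p K) :
    (∃ b, c = (ret b, K)) ∨ ∀ c' ∈ (instr c).targets, c' ∈ points p K := by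
  induction p generalizing K with
  | ite p q r hp hq hr =>
    rcases hc with rfl | hc | hc | hc
    · right
      exact List.forall_mem_singleton.2 (Or.inr (Or.inl (self_mem_points _ _)))
    · right
      rcases hp _ hc with ⟨_ | _, rfl⟩ | h
      · exact List.forall_mem_singleton.2 (Or.inr (Or.inr (Or.inr (self_mem_points _ _))))
      · exact List.forall_mem_singleton.2 (Or.inr (Or.inr (Or.inl (self_mem_points _ _))))
      · exact fun c' hc' => Or.inr (Or.inl (h c' hc'))
    · exact (hq _ hc).imp id fun h c' hc' => Or.inr (Or.inr (Or.inl (h c' hc')))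
    · exact (hr _ hc).imp id fun h c' hc' => Or.inr (Or.inr (Or.inr (h c' hc')))
  | rep p hp =>
    rcases hc with (rfl | rfl | rfl) | hc
    · right
      exact List.forall_mem_singleton.2 (Or.inr (self_mem_points _ _))
    · exact Or.inl ⟨_, rfl⟩
    · exact Or.inl ⟨_, rfl⟩
    · right
      rcases hp _ hc with ⟨_ | _, rfl⟩ | h
      · simp [instr, Instr.targets, points]
      · exact List.forall_mem_singleton.2 (Or.inr (self_mem_points _ _))
      · exact fun c' hc' => Or.inr (h c' hc')
  | inc i =>
    rcases hc with rfl | rfl | rfl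
    · exact Or.inr (by simp [instr, Instr.targets, points])
    · exact Or.inl ⟨_, rfl⟩
    · exact Or.inl ⟨_, rfl⟩
  | dec i =>
    rcases hc with rfl | rfl | rfl
    · exact Or.inr (by simp [instr, Instr.targets, points])
    · exact Or.inl ⟨_, rfl⟩
    · exact Or.inl ⟨_, rfl⟩
  | ret b =>
    rcases hc with rfl | rfl | rfl <;> exact Or.inl ⟨_, rfl⟩

variable {ι : Type} [DecidableEq ι]

/-- `Halts t c s`: started at the control point `c` with the counter values `s`, the machine
halts within fewer than `t` steps. -/
def Halts : ℕ → Ctl ι → (ι → ℕ) → Prop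
  | 0, _, _ => False
  | t + 1, c, s =>
    match instr c with
    | .halt => True
    | .nop c' => Halts t c' s
    | .inc i c' => Halts t c' (Function.update s i (s i + 1))
    | .dec i c₀ c₁ =>
      if s i = 0 then Halts t c₀ s else Halts t c₁ (Function.update s i (s i - 1))

theorem Halts.succ {t : ℕ} {c : Ctl ι} {s : ι → ℕ} (h : Halts t c s) : Halts (t + 1) c s := by
  induction t generalizing c s with
  | zero => exact h.elim
  | succ t ih =>
    rw [Halts] at h ⊢
    split at h
    · trivial
    · exact ih h
    · exact ih h
    · split_ifs at h ⊢
      · exact ih h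
      · exact ih h

/-- A terminating subprogram may be skipped in a computation that halts, without an increase of the
number of remaining steps. -/
theorem Run.halts {p : Prog ι} {s s' : ι → ℕ} {b : Bool} (h : Run p s s' b)
    {K : List (Frame ι)} {t : ℕ} (ht : Halts t (p, K) s) : Halts t (Prog.ret b, K) s' := by
  induction h generalizing K t with
  | inc i s =>
    rcases t with _ | t
    · exact ht
    · exact Halts.succ ht
  | decZero i s h0 =>
    rcases t with _ | t
    · exact ht
    · simp only [Halts, instr, h0, if_true] at ht
      exact ht.succ
  | decSucc i s k hk =>
    rcases t with _ | t
    · exact ht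
    · simp only [Halts, instr, hk, Nat.add_sub_cancel, Nat.succ_ne_zero, if_false] at ht
      exact ht.succ
  | ret b s => exact ht
  | iteTrue p q r s s' s'' b _ _ ih ih' =>
    rcases t with _ | t
    · exact ht
    have h1 := ih (K := .ite q r :: K) (t := t) ht
    rcases t with _ | t
    · exact h1.elim
    · exact (ih' (t := t) h1).succ.succ
  | iteFalse p q r s s' s'' b _ _ ih ih' =>
    rcases t with _ | t
    · exact ht
    have h1 := ih (K := .ite q r :: K) (t := t) ht
    rcases t with _ | t
    · exact h1.elim
    · exact (ih' (t := t) h1).succ.succ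
  | repTrue p s s' s'' b _ _ ih ih' =>
    rcases t with _ | t
    · exact ht
    have h1 := ih (K := .rep p :: K) (t := t) ht
    exact ih' (K := K) (t := t + 1) (by
      rcases t with _ | t
      · exact h1.elim
      · exact Halts.succ (t := t) (c := (p, .rep p :: K)) h1)
  | repFalse p s s' _ ih =>
    rcases t with _ | t
    · exact ht
    have h1 := ih (K := .rep p :: K) (t := t) ht
    rcases t with _ | t
    · exact h1.elim
    · exact Halts.succ (Halts.succ h1)

theorem Run.exists_halts {p : Prog ι} {s s' : ι → ℕ} {b : Bool} (h : Run p s s' b)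
    {K : List (Frame ι)} (ht : ∃ t, Halts t (Prog.ret b, K) s') : ∃ t, Halts t (p, K) s := by
  induction h generalizing K with
  | inc i s =>
    obtain ⟨t, ht⟩ := ht
    exact ⟨t + 1, ht⟩
  | decZero i s h0 =>
    obtain ⟨t, ht⟩ := ht
    exact ⟨t + 1, by simpa only [Halts, instr, h0, if_true] using ht⟩
  | decSucc i s k hk =>
    obtain ⟨t, ht⟩ := ht
    exact ⟨t + 1, by
      simpa only [Halts, instr, hk, Nat.add_sub_cancel, Nat.succ_ne_zero, if_false] using ht⟩
  | ret b s => exact ht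
  | iteTrue p q r s s' s'' b _ _ ih ih' =>
    obtain ⟨t, ht⟩ := ih' ht
    obtain ⟨u, hu⟩ := ih (K := .ite q r :: K) ⟨t + 1, ht⟩
    exact ⟨u + 1, hu⟩
  | iteFalse p q r s s' s'' b _ _ ih ih' =>
    obtain ⟨t, ht⟩ := ih' ht
    obtain ⟨u, hu⟩ := ih (K := .ite q r :: K) ⟨t + 1, ht⟩
    exact ⟨u + 1, hu⟩
  | repTrue p s s' s'' b _ _ ih ih' =>
    obtain ⟨_ | t, ht⟩ := ih' ht
    · exact ht.elim
    obtain ⟨u, hu⟩ := ih (K := .rep p :: K) ⟨t + 1, ht⟩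
    exact ⟨u + 1, hu⟩
  | repFalse p s s' _ ih =>
    obtain ⟨t, ht⟩ := ht
    obtain ⟨u, hu⟩ := ih (K := .rep p :: K) ⟨t + 1, ht⟩
    exact ⟨u + 1, hu⟩

/-! ### A two-counter program with undecidable halting problem -/

/-- The outcome of `k` steps of computation of the `n`-th partial recursive function at the
argument `0`: the value is `0` if the computation has terminated, and `1` otherwise. -/
def runsFor (n k : ℕ) : ℕ :=
  bif (Nat.Partrec.Code.evaln k (Denumerable.ofNat Nat.Partrec.Code n) 0).isSome then 0 else 1

theorem primrec_runsFor : Primrec₂ runsFor :=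
  Primrec.cond (Primrec.option_isSome.comp (Nat.Partrec.Code.primrec_evaln.comp
    ((Primrec.snd.pair ((Primrec.ofNat _).comp Primrec.fst)).pair (Primrec.const 0))))
    (Primrec.const 0) (Primrec.const 1)

theorem dom_iff_runsFor (c : Nat.Partrec.Code) :
    (c.eval 0).Dom ↔ ∃ k, runsFor (Encodable.encode c) k = 0 := by
  rw [Part.dom_iff_mem]
  simp only [Nat.Partrec.Code.evaln_complete, runsFor, Denumerable.ofNat_encode]
  rw [exists_comm]
  refine exists_congr fun k => ?_
  cases h : Nat.Partrec.Code.evaln k c 0 <;> simp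

/-- There is a program over two counters whose halting problem encodes that of all partial
recursive functions: it searches for a number of steps after which the given computation has
terminated. -/
theorem exists_universal_prog : ∃ p : Prog Bool, ∀ c : Nat.Partrec.Code,
    (∃ t, Halts t (p, []) (two (2 ^ Encodable.encode c) 0)) ↔ (c.eval 0).Dom := by
  obtain ⟨P, hP⟩ := computes_of_primrec' (Nat.Primrec'.prim_iff₂.2 primrec_runsFor)
    (fun i => i.val) 2 3 (fun i => by omega) (by omega) (fun i => by omega)
  set B : Prog ℕ := seq P (ite (dec 2) (inc 1) (ret false)) with hB
  refine ⟨rep (toTwo B), fun c => ?_⟩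
  rw [dom_iff_runsFor]
  set n := Encodable.encode c
  set st : ℕ → ℕ → ℕ := fun k => Function.update (Function.update 0 0 n) 1 k with hst
  have hP' : ∀ k, Does P (st k) (Function.update (st k) 2 (runsFor n k)) := fun k =>
    (hP (st k) fun j hj => by
      simp [hst, show j ≠ 1 by omega, show j ≠ 0 by omega]).of_eq (by
        simp [hst, List.Vector.ofFn])
  have hyes : ∀ k, runsFor n k = 0 → Run B (st k) (st k) false := fun k hk => by
    refine run_seq (hP' k) (run_ite_dec_zero (by simp [hk]) ?_)
    have : Function.update (st k) 2 (runsFor n k) = st k := by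
      rw [hk, Function.update_eq_self_iff]
      simp [hst]
    rw [this]
    exact .ret _ _
  have hno : ∀ k, runsFor n k ≠ 0 → Run B (st k) (st (k + 1)) true := fun k hk => by
    have h1 : runsFor n k = 0 + 1 := by
      unfold runsFor at hk ⊢
      revert hk
      cases (Nat.Partrec.Code.evaln k (Denumerable.ofNat Nat.Partrec.Code n) 0).isSome <;> simp
    refine run_seq (hP' k) (run_ite_dec_succ (k := 0) (by simp [h1]) ?_)
    convert Run.inc 1 (Function.update (Function.update (st k) 2 (runsFor n k)) 2 0) using 1
    ext j
    simp only [hst, Function.update_apply]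
    split_ifs <;> simp_all
  have h0 : Godel (st 0) (2 ^ n) := by
    refine ⟨by positivity, fun i => ?_⟩
    rw [Nat.prime_two.factorization_pow, Finsupp.single_apply]
    rcases Nat.eq_zero_or_pos i with rfl | hi
    · simp [hst, Nat.nth_prime_zero_eq_two]
    · have : 2 ≠ Nat.nth Nat.Prime i := fun e => hi.ne
        (Nat.nth_injective Nat.infinite_setOfPred_prime (Nat.nth_prime_zero_eq_two.trans e))
      simp [this, hst, Function.update_apply, hi.ne']
  constructor
  · rintro ⟨t, ht⟩
    by_contra hne
    push Not at hne
    have key : ∀ t k x, Godel (st k) x → ¬Halts t (rep (toTwo B), []) (two x 0) := by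
      intro t
      induction t with
      | zero => exact fun _ _ _ h => h
      | succ t ih =>
        intro k x hx h
        obtain ⟨x', hx', h'⟩ := (hno k (hne k)).toTwo hx
        have h1 := h'.halts (K := [.rep (toTwo B)]) (t := t) h
        rcases t with _ | t
        · exact h1
        · exact ih (k + 1) x' hx' h1
    exact key t 0 _ h0 ht
  · intro hex
    classical
    obtain ⟨hk, hmin⟩ := And.intro (Nat.find_spec hex) fun m => Nat.find_min hex (m := m)
    set k := Nat.find hex
    have key : ∀ m ≤ k, ∀ x, Godel (st (k - m)) x →
        ∃ x', Run (rep (toTwo B)) (two x 0) (two x' 0) false := by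
      intro m
      induction m with
      | zero =>
        intro _ x hx
        obtain ⟨x', -, h'⟩ := (hyes k hk).toTwo hx
        exact ⟨x', .repFalse _ _ _ h'⟩
      | succ m ih =>
        intro hm x hx
        obtain ⟨x', hx', h'⟩ := (hno (k - (m + 1)) (hmin _ (by omega))).toTwo hx
        rw [show k - (m + 1) + 1 = k - m by omega] at hx'
        obtain ⟨x'', h''⟩ := ih (by omega) x' hx'
        exact ⟨x'', .repTrue _ _ _ _ _ h' h''⟩
    obtain ⟨x', h'⟩ := key k le_rfl _ (by rwa [Nat.sub_self])
    exact h'.exists_halts ⟨1, trivial⟩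

end Prog

/-! ### Viability games and closed sets of configurations -/

/-- `X` is a set of configurations in which the existential player can stay forever, in the game
with transitions `T` and states `E` of the existential player: all configurations in `X` are
right-invertible, the existential player can move to a configuration in `X`, and the universal
player has no move that leaves `X`. -/
structure IsViable {V S : Type} (Γ : ValenceGraph V) (T : S → List (Letter V) → S → Prop)
    (E : S → Prop) (X : S → Γ.GraphMonoid → Prop) : Prop where
  rinv : ∀ s x, X s x → x ∈ Γ.RInv
  ex : ∀ s x, X s x → E s → ∃ w s', T s w s' ∧ X s' (x * Γ.elt w)
  all : ∀ s x, X s x → ¬E s → ∀ w s', T s w s' → X s' (x * Γ.elt w)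

/-- The configuration lies in a set in which the existential player can stay forever. -/
def Viable {V S : Type} (Γ : ValenceGraph V) (T : S → List (Letter V) → S → Prop)
    (E : S → Prop) (s : S) (x : Γ.GraphMonoid) : Prop :=
  ∃ X, IsViable Γ T E X ∧ X s x

theorem isViable_viable {V S : Type} (Γ : ValenceGraph V) (T : S → List (Letter V) → S → Prop)
    (E : S → Prop) : IsViable Γ T E (Viable Γ T E) where
  rinv s x := fun ⟨_, hX, hs⟩ => hX.rinv s x hs
  ex s x := fun ⟨X, hX, hs⟩ he =>
    let ⟨w, s', hT, hs'⟩ := hX.ex s x hs he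
    ⟨w, s', hT, X, hX, hs'⟩
  all s x := fun ⟨X, hX, hs⟩ he w s' hT => ⟨X, hX, hX.all s x hs he w s' hT⟩

namespace Arena

variable {V : Type} {A : Arena V} {Γ : ValenceGraph V}

/-- The transition relation of an arena. -/
def Trans (A : Arena V) (p : ℕ) (w : List (Letter V)) (q : ℕ) : Prop := (p, w, q) ∈ A.trans

theorem exists_play (hA : A.IsArena) {σ : List ℕ → ℕ → ℕ} (hσ : A.IsStrategy σ) {q : ℕ}
    (hq : q < A.owner.length) (x : Γ.GraphMonoid) :
    ∃ π, A.IsPlay Γ π ∧ π 0 = (q, x) ∧ A.Compliant Γ σ π := by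
  have hnext : ∀ (h : List ℕ) (p : ℕ), ∃ (w : List (Letter V)) (p' : ℕ), p < A.owner.length →
      (p, w, p') ∈ A.trans ∧ (A.IsExists p → σ h p = p') := by
    intro h p
    by_cases hp : p < A.owner.length
    · by_cases he : A.IsExists p
      · obtain ⟨w, hw⟩ := hσ h p he
        exact ⟨w, _, fun _ => ⟨hw, fun _ => rfl⟩⟩
      · obtain ⟨w, p', hw⟩ := hA.no_dead_end p hp
        exact ⟨w, p', fun _ => ⟨hw, fun h' => (he h').elim⟩⟩
    · exact ⟨[], 0, fun h' => (hp h').elim⟩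
  choose w nx hn using hnext
  let c : ℕ → List ℕ × ℕ × Γ.GraphMonoid := fun i => Nat.rec ([], q, x)
    (fun _ c => (c.1 ++ [c.2.1], nx c.1 c.2.1, c.2.2 * Γ.elt (w c.1 c.2.1))) i
  have hlt : ∀ i, (c i).2.1 < A.owner.length := by
    intro i
    induction i with
    | zero => exact hq
    | succ i ih => exact (hA.trans_lt _ _ _ (hn _ _ ih).1).2
  have hh : ∀ i, (c i).1 = (List.range i).map fun j => (c j).2.1 := by
    intro i
    induction i with
    | zero => rfl
    | succ i ih => rw [List.range_succ, List.map_append, ← ih]; rfl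
  refine ⟨fun i => (c i).2, fun i => ⟨_, (hn _ _ (hlt i)).1, rfl⟩, rfl, fun i he => ?_⟩
  rw [← hh i]
  exact (hn _ _ (hlt i)).2 he

theorem existsWins_of_trans {σ : List ℕ → ℕ → ℕ} (hσ : A.IsStrategy σ) {q q' : ℕ}
    {w : List (Letter V)} {x : Γ.GraphMonoid}
    (hwin : ∀ π : ℕ → ℕ × Γ.GraphMonoid, A.IsPlay Γ π → π 0 = (q, x) → A.Compliant Γ σ π →
      ∀ i, (π i).2 ∈ Γ.RInv)
    (hT : (q, w, q') ∈ A.trans) (he : A.IsExists q → σ [] q = q') :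
    A.ExistsWins Γ q' (x * Γ.elt w) := by
  refine ⟨fun h p => σ (q :: h) p, fun h p hp => hσ _ p hp, fun π hπ h0 hc i => ?_⟩
  refine hwin (fun i => Nat.casesOn i (q, x) π) ?_ rfl ?_ (i + 1)
  · rintro (_ | i)
    · exact ⟨w, by simpa [h0] using hT, by simp [h0]⟩
    · exact hπ i
  · rintro (_ | i) hi
    · simpa [h0] using he hi
    · simpa [List.range_succ_eq_map, Function.comp_def] using hc i hi

/-- `A.History Γ q₀ x₀ h q x`: a play from `(q₀, x₀)` can visit the states `h` and then be in the
configuration `(q, x)`. -/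
inductive History (A : Arena V) (Γ : ValenceGraph V) (q₀ : ℕ) (x₀ : Γ.GraphMonoid) :
    List ℕ → ℕ → Γ.GraphMonoid → Prop
  | nil : History A Γ q₀ x₀ [] q₀ x₀
  | snoc (h q x w q') : History A Γ q₀ x₀ h q x → (q, w, q') ∈ A.trans →
      History A Γ q₀ x₀ (h ++ [q]) q' (x * Γ.elt w)

theorem History.unique (hA : A.IsArena) {q₀ : ℕ} {x₀ : Γ.GraphMonoid} {h : List ℕ} {q : ℕ}
    {x y : Γ.GraphMonoid} (hx : A.History Γ q₀ x₀ h q x) (hy : A.History Γ q₀ x₀ h q y) :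
    x = y := by
  induction hx generalizing y with
  | nil =>
    generalize hl : ([] : List ℕ) = l at hy
    cases hy with
    | nil => rfl
    | snoc => simp at hl
  | snoc h p x w q hx hT ih =>
    generalize hl : h ++ [p] = l at hy
    cases hy with
    | nil => simp at hl
    | snoc h' p' x' w' _ hx' hT' =>
      obtain ⟨rfl, hp⟩ := List.append_inj' hl rfl
      obtain rfl : p = p' := by simpa using hp
      rw [ih hx', hA.unique _ _ _ _ hT hT']

/-- The existential player wins from exactly those configurations from which she can stay in a
closed set. As the labels of the transitions are determined by their end points, she can compute the
current monoid element from the history of states. -/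
theorem existsWins_iff_viable (hA : A.IsArena) {q : ℕ} (hq : q < A.owner.length)
    (x : Γ.GraphMonoid) : A.ExistsWins Γ q x ↔ Viable Γ A.Trans A.IsExists q x := by
  constructor
  · intro hw
    refine ⟨fun q x => q < A.owner.length ∧ A.ExistsWins Γ q x, ⟨?_, ?_, ?_⟩, hq, hw⟩
    · rintro q x ⟨hq, σ, hσ, hwin⟩
      obtain ⟨π, hπ, h0, hc⟩ := exists_play hA hσ hq x
      simpa [h0] using hwin π hπ h0 hc 0
    · rintro q x ⟨hq, σ, hσ, hwin⟩ he
      obtain ⟨w, hT⟩ := hσ [] q he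
      exact ⟨w, _, hT, (hA.trans_lt _ _ _ hT).2, existsWins_of_trans hσ hwin hT fun _ => rfl⟩
    · rintro q x ⟨hq, σ, hσ, hwin⟩ he w q' hT
      exact ⟨(hA.trans_lt _ _ _ hT).2, existsWins_of_trans hσ hwin hT fun h => (he h).elim⟩
  · rintro ⟨X, hX, hqx⟩
    have hchoice : ∀ (h : List ℕ) (p : ℕ), ∃ p' : ℕ, A.IsExists p →
        (∃ w, (p, w, p') ∈ A.trans) ∧ ∀ y, A.History Γ q x h p y → X p y →
          ∃ w, (p, w, p') ∈ A.trans ∧ X p' (y * Γ.elt w) := by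
      intro h p
      by_cases hy : ∃ y, A.History Γ q x h p y ∧ X p y
      · obtain ⟨y, hy, hXy⟩ := hy
        by_cases he : A.IsExists p
        · obtain ⟨w, p', hT, hX'⟩ := hX.ex p y hXy he
          refine ⟨p', fun _ => ⟨⟨w, hT⟩, fun y' hy' _ => ?_⟩⟩
          obtain rfl := hy.unique hA hy'
          exact ⟨w, hT, hX'⟩
        · exact ⟨0, fun h => (he h).elim⟩
      · by_cases he : A.IsExists p
        · have hp : p < A.owner.length := (List.getElem?_eq_some_iff.1 he).1
          obtain ⟨w, p', hT⟩ := hA.no_dead_end p hp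
          exact ⟨p', fun _ => ⟨⟨w, hT⟩, fun y h1 h2 => (hy ⟨y, h1, h2⟩).elim⟩⟩
        · exact ⟨0, fun h => (he h).elim⟩
    choose σ hσ using hchoice
    refine ⟨σ, fun h p he => (hσ h p he).1, fun π hπ h0 hc => ?_⟩
    have key : ∀ i, A.History Γ q x ((List.range i).map fun j => (π j).1) (π i).1 (π i).2 ∧
        X (π i).1 (π i).2 := by
      intro i
      induction i with
      | zero =>
        rw [h0]
        exact ⟨.nil, hqx⟩
      | succ i ih =>
        obtain ⟨w, hT, he⟩ := hπ i
        rw [List.range_succ, List.map_append, he]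
        refine ⟨.snoc _ _ _ _ _ ih.1 hT, ?_⟩
        by_cases hE : A.IsExists (π i).1
        · obtain ⟨w', hT', hX'⟩ := (hσ _ _ hE).2 _ ih.1 ih.2
          rw [hc i hE] at hT' hX'
          rwa [hA.unique _ _ _ _ hT hT']
        · exact hX.all _ _ ih.2 hE _ _ hT
    exact fun i => hX.rinv _ _ (key i).2

/-- A state with only one outgoing transition. -/
theorem viable_iff_of_forall_trans {p p' : ℕ} {w : List (Letter V)}
    (h : ∀ v q, A.Trans p v q ↔ v = w ∧ q = p') (x : Γ.GraphMonoid) :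
    Viable Γ A.Trans A.IsExists p x ↔
      x ∈ Γ.RInv ∧ Viable Γ A.Trans A.IsExists p' (x * Γ.elt w) := by
  have hV := isViable_viable Γ A.Trans A.IsExists
  constructor
  · intro hp
    refine ⟨hV.rinv _ _ hp, ?_⟩
    by_cases he : A.IsExists p
    · obtain ⟨v, q, hT, hq⟩ := hV.ex _ _ hp he
      obtain ⟨rfl, rfl⟩ := (h _ _).1 hT
      exact hq
    · exact hV.all _ _ hp he _ _ ((h _ _).2 ⟨rfl, rfl⟩)
  · rintro ⟨hx, X, hX, hp'⟩
    refine ⟨fun q y => X q y ∨ q = p ∧ y = x, ⟨?_, ?_, ?_⟩, Or.inr ⟨rfl, rfl⟩⟩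
    · rintro q y (hq | ⟨rfl, rfl⟩)
      exacts [hX.rinv _ _ hq, hx]
    · rintro q y (hq | ⟨rfl, rfl⟩) he
      · obtain ⟨v, q', hT, hq'⟩ := hX.ex _ _ hq he
        exact ⟨v, q', hT, Or.inl hq'⟩
      · exact ⟨w, p', (h _ _).2 ⟨rfl, rfl⟩, Or.inl hp'⟩
    · rintro q y (hq | ⟨rfl, rfl⟩) he v q' hT
      · exact Or.inl (hX.all _ _ hq he _ _ hT)
      · obtain ⟨rfl, rfl⟩ := (h _ _).1 hT
        exact Or.inl hp'

/-- An arena contains a copy of the part `W` of a game, such that no transition leads out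
of it. -/
theorem viable_embedding {S : Type} {T : S → List (Letter V) → S → Prop} {E : S → Prop}
    {W : Set S} (ν : S → ℕ)
    (hW : ∀ s ∈ W, ∀ w s', T s w s' → s' ∈ W)
    (hE : ∀ s ∈ W, A.IsExists (ν s) ↔ E s)
    (hT : ∀ s ∈ W, ∀ w q, A.Trans (ν s) w q ↔ ∃ s', T s w s' ∧ q = ν s')
    {s : S} (hs : s ∈ W) (x : Γ.GraphMonoid) :
    Viable Γ A.Trans A.IsExists (ν s) x ↔ Viable Γ T E s x := by
  constructor
  · rintro ⟨X, hX, hx⟩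
    refine ⟨fun s x => s ∈ W ∧ X (ν s) x, ⟨?_, ?_, ?_⟩, hs, hx⟩
    · exact fun s x h => hX.rinv _ _ h.2
    · rintro s x ⟨hs, h⟩ he
      obtain ⟨w, q, hq, hq'⟩ := hX.ex _ _ h ((hE s hs).2 he)
      obtain ⟨s', hs', rfl⟩ := (hT s hs w q).1 hq
      exact ⟨w, s', hs', hW s hs _ _ hs', hq'⟩
    · rintro s x ⟨hs, h⟩ he w s' hs'
      exact ⟨hW s hs _ _ hs', hX.all _ _ h (fun h' => he ((hE s hs).1 h')) _ _
        ((hT s hs _ _).2 ⟨s', hs', rfl⟩)⟩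
  · rintro ⟨X, hX, hx⟩
    refine ⟨fun q x => ∃ s ∈ W, q = ν s ∧ X s x, ⟨?_, ?_, ?_⟩, s, hs, rfl, hx⟩
    · rintro _ x ⟨s, hs, rfl, h⟩
      exact hX.rinv _ _ h
    · rintro _ x ⟨s, hs, rfl, h⟩ he
      obtain ⟨w, s', hs', h'⟩ := hX.ex _ _ h ((hE s hs).1 he)
      exact ⟨w, ν s', (hT s hs _ _).2 ⟨s', hs', rfl⟩, s', hW s hs _ _ hs', rfl, h'⟩
    · rintro _ x ⟨s, hs, rfl, h⟩ he w q hq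
      obtain ⟨s', hs', rfl⟩ := (hT s hs _ _).1 hq
      exact ⟨s', hW s hs _ _ hs', rfl, hX.all _ _ h (fun h' => he ((hE s hs).2 h')) _ _ hs'⟩

end Arena

/-! ### Graph monoids -/

namespace ValenceGraph

variable {V : Type} (Γ : ValenceGraph V)

theorem elt_nil : Γ.elt [] = 1 := rfl

theorem elt_cancel (v : V) : Γ.elt [(v, true)] * Γ.elt [(v, false)] = 1 :=
  PresentedMonoid.mk_eq_mk_of_rel (.cancel v)

theorem commute_elt {u v : V} (h : s(u, v) ∈ Γ.edges) (i j : Bool) :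
    Commute (Γ.elt [(u, i)]) (Γ.elt [(v, j)]) :=
  PresentedMonoid.mk_eq_mk_of_rel (.comm u v i j h)

/-- The right-invertible elements form a submonoid. -/
def rInvSubmonoid : Submonoid Γ.GraphMonoid where
  carrier := Γ.RInv
  one_mem' := ⟨1, one_mul 1⟩
  mul_mem' := by
    rintro x x' ⟨y, hy⟩ ⟨y', hy'⟩
    exact ⟨y' * y, by rw [mul_assoc, ← mul_assoc x', hy', one_mul, hy]⟩

theorem elt_mem_rInvSubmonoid (v : V) : Γ.elt [(v, true)] ∈ Γ.rInvSubmonoid :=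
  ⟨_, Γ.elt_cancel v⟩

end ValenceGraph

/-- The contents of a stack whose entries consist of a natural number and an integer: the entries
below the top, and the top entry. -/
abbrev Stack := List (ℕ × ℤ) × (ℕ × ℤ)

namespace Stack

/-- If the top entry is nonempty, push an empty entry; remove an empty top entry if the entry
below is nonempty; otherwise do nothing. This is an involution, so no stack has to be excluded as
not reduced. -/
def flip : Stack → Stack
  | ([], g) => if g = 0 then ([], g) else ([g], 0)
  | (g' :: L, g) => if g = 0 then (if g' = 0 then (g' :: L, g) else (L, g'))
      else (g :: g' :: L, 0)

theorem flip_flip (S : Stack) : S.flip.flip = S := by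
  obtain ⟨_ | ⟨g', L⟩, g⟩ := S
  · by_cases h : g = 0 <;> simp [flip, h]
  · by_cases h : g = 0
    · by_cases h' : g' = 0
      · simp [flip, h, h']
      · subst h
        rcases L with _ | ⟨g'', L⟩ <;> simp [flip, h']
    · simp [flip, h]

theorem flip_of_ne {L : List (ℕ × ℤ)} {g : ℕ × ℤ} (h : g ≠ 0) :
    flip (L, g) = (g :: L, 0) := by
  rcases L with _ | ⟨g', L⟩ <;> simp [flip, h]

/-- The partial action of the letters on stacks. Both `a` and `ā` act as the involution `flip`; the
letters `b`, `b̄` increment and decrement the natural number in the top entry, and `c`, `c̄`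
increment and decrement the integer. Only `b̄` is partial. -/
def act : Letter (Fin 3) → Stack → Option Stack
  | (0, _), S => some S.flip
  | (1, true), (L, (n, z)) => some (L, (n + 1, z))
  | (1, false), (L, (n + 1, z)) => some (L, (n, z))
  | (1, false), (_, (0, _)) => none
  | (2, true), (L, (n, z)) => some (L, (n, z + 1))
  | (2, false), (L, (n, z)) => some (L, (n, z - 1))

/-- The letters as transformations of `Option Stack`, acting from the right. -/
def actEnd (l : Letter (Fin 3)) : (Function.End (Option Stack))ᵐᵒᵖ :=
  MulOpposite.op fun S => S.bind (act l)

end Stack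

namespace ValenceGraph

/-- The only edges are those between `b` and `c`, and self-loops at `a` and `c`. -/
def IsSmall (Γ : ValenceGraph (Fin 3)) : Prop :=
  Γ.edges ⊆ {s(1, 2), s(2, 2), s(0, 0)}

variable {Γ : ValenceGraph (Fin 3)} (hΓ : Γ.IsSmall)

/-- The action of the graph monoid on stacks. -/
def actHom : Γ.GraphMonoid →* (Function.End (Option Stack))ᵐᵒᵖ :=
  PresentedMonoid.lift Stack.actEnd (by
    rintro _ _ (v | ⟨u, v, i, j, h⟩)
    · simp only [map_mul, FreeMonoid.lift_eval_of, map_one]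
      apply MulOpposite.unop_injective
      funext S
      rcases S with _ | ⟨L, n, z⟩
      · rfl
      · change ((Stack.act (v, true) (L, n, z)).bind _) = some _
        fin_cases v
        · exact congrArg some (Stack.flip_flip _)
        · rfl
        · simp [Stack.act]
    · simp only [map_mul, FreeMonoid.lift_eval_of]
      apply MulOpposite.unop_injective
      funext S
      rcases S with _ | ⟨L, n, z⟩
      · rfl
      · change ((Stack.act (u, i) (L, n, z)).bind _) = (Stack.act (v, j) (L, n, z)).bind _
        rcases hΓ h with h | h | h
        · rcases Sym2.eq_iff.1 h with ⟨rfl, rfl⟩ | ⟨rfl, rfl⟩ <;>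
            rcases n with _ | n <;> cases i <;> cases j <;> rfl
        · rcases Sym2.eq_iff.1 h with ⟨rfl, rfl⟩ | ⟨rfl, rfl⟩ <;>
            cases i <;> cases j <;> simp [Stack.act]
        · rcases Sym2.eq_iff.1 h with ⟨rfl, rfl⟩ | ⟨rfl, rfl⟩ <;> rfl)

/-- The stack produced from an empty one, if it is defined. -/
def stack (x : Γ.GraphMonoid) : Option Stack := (actHom hΓ x).unop (some ([], 0))

theorem stack_mul_elt (x : Γ.GraphMonoid) (l : Letter (Fin 3)) :
    stack hΓ (x * Γ.elt [l]) = (stack hΓ x).bind (Stack.act l) := by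
  unfold stack
  rw [map_mul]
  rfl

theorem actHom_none (y : Γ.GraphMonoid) : (actHom hΓ y).unop none = none := by
  induction y using PresentedMonoid.inductionOn with | _ w
  induction w with
  | one => rfl
  | of l => rfl
  | mul u v hu hv =>
    rw [map_mul, map_mul]
    change (actHom hΓ (PresentedMonoid.mk Γ.Rel v)).unop
      ((actHom hΓ (PresentedMonoid.mk Γ.Rel u)).unop none) = none
    rw [hu, hv]

theorem stack_ne_none {x : Γ.GraphMonoid} (hx : x ∈ Γ.RInv) : stack hΓ x ≠ none := by
  obtain ⟨y, hy⟩ := hx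
  intro h
  have h1 : (actHom hΓ (x * y)).unop (some ([], 0)) = some ([], 0) := by
    rw [hy, map_one]; rfl
  rw [map_mul] at h1
  change (actHom hΓ y).unop (stack hΓ x) = _ at h1
  rw [h, actHom_none] at h1
  cases h1

end ValenceGraph

/-! ### The game played on a two-counter program -/

namespace CounterGame

open ValenceGraph Prog

/-- The states of the game. In `run c`, the instruction at the control point `c` is to be executed;
`incMid` and `decMid` occur during the execution of an increment and a decrement. In `zero i c`, the
existential player has claimed that the counter `i` is zero, and in `pos c`, she has claimed that
the previous decrement was legitimate; the universal player may continue at `c` or have the claim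
tested. In `drain t`, the existential player has to empty the counters, but must not access the
counter `i` if `t = some i`; `mid` occurs during the decrements, and `pop` at the end of this test.
In `done`, the existential player has won, and in `fail` and `fail'` she is about to lose. -/
inductive State
  | run (c : Ctl Bool)
  | incMid (i : Bool) (c : Ctl Bool)
  | zero (i : Bool) (c : Ctl Bool)
  | decMid (i : Bool) (c : Ctl Bool)
  | pos (c : Ctl Bool)
  | drain (t : Option Bool)
  | mid (t : Option Bool) (i : Bool)
  | pop
  | done
  | fail
  | fail'

/-- The outgoing transitions of a state, as pairs of a label and a target. -/
def next : State → List (List (Letter (Fin 3)) × State)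
  | .run c =>
    match instr c with
    | .halt => [([(1, true)], .fail)]
    | .nop c' => [([], .run c')]
    | .inc i c' => [([(1, true)], .incMid i c')]
    | .dec i c₀ c₁ => [([], .zero i c₀), ([(1, false)], .decMid i c₁)]
  | .incMid i c => [(bif i then [(2, true)] else [], .run c)]
  | .zero i c => [([], .run c), ([], .drain (some i))]
  | .decMid i c => [(bif i then [(2, false)] else [], .pos c)]
  | .pos c => [([], .run c), ([], .drain none)]
  | .drain none =>
    [([(0, false)], .pop), ([(1, false)], .mid none false), ([(1, false)], .mid none true)]
  | .drain (some i) => [([(0, false)], .pop), ([(1, false)], .mid (some i) !i)]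
  | .mid t i => [(bif i then [(2, false)] else [], .drain t)]
  | .pop => [([(1, false)], .done)]
  | .done => [([], .done)]
  | .fail => [([(0, true)], .fail')]
  | .fail' => [([(1, false)], .done)]

/-- The transition relation of the game. -/
def Trans (s : State) (w : List (Letter (Fin 3))) (s' : State) : Prop := (w, s') ∈ next s

/-- The universal player owns the states in which a claim may be tested. -/
def owner : State → Bool
  | .zero _ _ => false
  | .pos _ => false
  | _ => true

/-- `s` is a state of the existential player. -/
def IsExists (s : State) : Prop := owner s = true

variable {Γ : ValenceGraph (Fin 3)}

/-- The credit that represents the counter values `x` and `y`: the number of letters `b` is `x + y`,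
so that the number of operations on both counters together is bounded by an `ℕ`-counter. -/
def credit (Γ : ValenceGraph (Fin 3)) (x y : ℕ) : Γ.GraphMonoid :=
  Γ.elt [(1, true)] * Γ.elt [(0, true)] * Γ.elt [(1, true)] ^ (x + y) * Γ.elt [(2, true)] ^ y

theorem credit_mem (x y : ℕ) : credit Γ x y ∈ Γ.rInvSubmonoid :=
  mul_mem (mul_mem (mul_mem (elt_mem_rInvSubmonoid _ _) (elt_mem_rInvSubmonoid _ _))
    (pow_mem (elt_mem_rInvSubmonoid _ _) _)) (pow_mem (elt_mem_rInvSubmonoid _ _) _)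

section Credit

variable (hbc : s(1, 2) ∈ Γ.edges)
include hbc

theorem credit_mul_b (x y : ℕ) : credit Γ x y * Γ.elt [(1, true)] = credit Γ (x + 1) y := by
  unfold credit
  rw [mul_assoc _ _ (Γ.elt [(1, true)]), ((Γ.commute_elt hbc true true).pow_right y).eq.symm,
    ← mul_assoc, mul_assoc _ (Γ.elt [(1, true)] ^ (x + y)), ← pow_succ, Nat.add_right_comm]

theorem credit_mul_b_mul_c (x y : ℕ) :
    credit Γ x y * Γ.elt [(1, true)] * Γ.elt [(2, true)] = credit Γ x (y + 1) := by
  rw [credit_mul_b hbc]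
  unfold credit
  rw [mul_assoc _ _ (Γ.elt [(2, true)]), ← pow_succ, Nat.add_right_comm, Nat.add_assoc]

theorem credit_succ_mul_b' (x y : ℕ) :
    credit Γ (x + 1) y * Γ.elt [(1, false)] = credit Γ x y := by
  unfold credit
  rw [mul_assoc _ _ (Γ.elt [(1, false)]), ((Γ.commute_elt hbc false true).pow_right y).eq.symm,
    ← mul_assoc, mul_assoc _ (Γ.elt [(1, true)] ^ (x + 1 + y)), Nat.add_right_comm, pow_succ,
    mul_assoc (_ ^ _), Γ.elt_cancel, mul_one]

theorem credit_mul_b'_right (x y : ℕ) :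
    credit Γ x (y + 1) * Γ.elt [(1, false)] = credit Γ x y * Γ.elt [(2, true)] := by
  rw [← credit_mul_b_mul_c hbc, mul_assoc _ (Γ.elt [(2, true)]),
    (Γ.commute_elt hbc false true).eq.symm, mul_assoc, ← mul_assoc _ _ (Γ.elt [(2, true)]),
    Γ.elt_cancel, one_mul]

end Credit

theorem credit_zero_mul_a' : credit Γ 0 0 * Γ.elt [(0, false)] = Γ.elt [(1, true)] := by
  unfold credit
  rw [Nat.add_zero, pow_zero, pow_zero, mul_one, mul_one, mul_assoc, Γ.elt_cancel, mul_one]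

/-! ### The existential player wins if the program does not halt -/

/-- The configurations visited when the existential player plays honestly and the program does not
halt. -/
def Honest (Γ : ValenceGraph (Fin 3)) : State → Γ.GraphMonoid → Prop
  | .run c, e => ∃ x y, e = credit Γ x y ∧ ∀ t, ¬Halts t c (two x y)
  | .incMid i c, e => ∃ x y, e = credit Γ x y * Γ.elt [(1, true)] ∧
      ∀ t, ¬Halts t c (Function.update (two x y) i (two x y i + 1))
  | .zero i c, e => ∃ x y, e = credit Γ x y ∧ two x y i = 0 ∧ ∀ t, ¬Halts t c (two x y)
  | .decMid i c, e => ∃ x y, e = credit Γ x y * Γ.elt (bif i then [(2, true)] else []) ∧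
      ∀ t, ¬Halts t c (two x y)
  | .pos c, e => ∃ x y, e = credit Γ x y ∧ ∀ t, ¬Halts t c (two x y)
  | .drain t, e => ∃ x y, e = credit Γ x y ∧ ∀ i, t = some i → two x y i = 0
  | .mid t i, e => ∃ x y, e = credit Γ x y * Γ.elt (bif i then [(2, true)] else []) ∧
      ∀ i, t = some i → two x y i = 0
  | .pop, e => e = Γ.elt [(1, true)]
  | .done, e => e = 1
  | .fail, _ => False
  | .fail', _ => False

theorem isViable_honest (hbc : s(1, 2) ∈ Γ.edges) : IsViable Γ Trans IsExists (Honest Γ) where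
  rinv s e h := by
    change e ∈ Γ.rInvSubmonoid
    have hi : ∀ i : Bool, Γ.elt (bif i then [(2, true)] else []) ∈ Γ.rInvSubmonoid := by
      rintro (_ | _)
      exacts [one_mem _, elt_mem_rInvSubmonoid _ _]
    cases s with
    | run => obtain ⟨x, y, rfl, -⟩ := h; exact credit_mem x y
    | incMid =>
      obtain ⟨x, y, rfl, -⟩ := h
      exact mul_mem (credit_mem x y) (elt_mem_rInvSubmonoid _ _)
    | zero => obtain ⟨x, y, rfl, -⟩ := h; exact credit_mem x y
    | decMid => obtain ⟨x, y, rfl, -⟩ := h; exact mul_mem (credit_mem x y) (hi _)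
    | pos => obtain ⟨x, y, rfl, -⟩ := h; exact credit_mem x y
    | drain => obtain ⟨x, y, rfl, -⟩ := h; exact credit_mem x y
    | mid => obtain ⟨x, y, rfl, -⟩ := h; exact mul_mem (credit_mem x y) (hi _)
    | pop => obtain rfl := h; exact elt_mem_rInvSubmonoid _ _
    | done => obtain rfl := h; exact one_mem _
    | fail => exact h.elim
    | fail' => exact h.elim
  ex s e h he := by
    have hc' : ∀ (i : Bool) (x y : ℕ), credit Γ x y * Γ.elt (bif i then [(2, true)] else []) *
        Γ.elt (bif i then [(2, false)] else []) = credit Γ x y := by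
      rintro (_ | _) x y
      · simp [elt_nil]
      · rw [mul_assoc]
        exact (congrArg _ (Γ.elt_cancel 2)).trans (mul_one _)
    -- both counters are decremented by first removing a letter `b`
    have hb' : ∀ (i : Bool) (x y : ℕ), two x y i ≠ 0 → ∃ x' y',
        two x' y' = Function.update (two x y) i (two x y i - 1) ∧
        credit Γ x y * Γ.elt [(1, false)] =
          credit Γ x' y' * Γ.elt (bif i then [(2, true)] else []) := by
      rintro (_ | _) x y hi
      · obtain ⟨x, rfl⟩ := Nat.exists_eq_succ_of_ne_zero (n := x) hi
        exact ⟨x, y, by simp, by simpa [elt_nil] using credit_succ_mul_b' hbc x y⟩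
      · obtain ⟨y, rfl⟩ := Nat.exists_eq_succ_of_ne_zero (n := y) hi
        exact ⟨x, y, by simp, credit_mul_b'_right hbc x y⟩
    cases s with
    | run c =>
      obtain ⟨x, y, rfl, hn⟩ := h
      simp only [Trans, next]
      cases hins : instr c with
      | halt => exact (hn 1 (by simp [Halts, hins])).elim
      | nop c' =>
        refine ⟨_, _, List.mem_singleton_self _, x, y, by simp [elt_nil], fun t ht => hn (t + 1) ?_⟩
        simpa only [Halts, hins] using ht
      | inc i c' =>
        refine ⟨_, _, List.mem_singleton_self _, x, y, rfl, fun t ht => hn (t + 1) ?_⟩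
        simpa only [Halts, hins] using ht
      | dec i c₀ c₁ =>
        by_cases hi : two x y i = 0
        · refine ⟨_, .zero i c₀, List.mem_cons_self, x, y, by simp [elt_nil], hi,
            fun t ht => hn (t + 1) ?_⟩
          simpa only [Halts, hins, hi, if_true] using ht
        · obtain ⟨x', y', h1, h2⟩ := hb' i x y hi
          refine ⟨_, .decMid i c₁, List.mem_cons_of_mem _ List.mem_cons_self, x', y', h2,
            fun t ht => hn (t + 1) ?_⟩
          rw [h1] at ht
          simpa only [Halts, hins, hi, if_false] using ht
    | incMid i c =>
      obtain ⟨x, y, rfl, hn⟩ := h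
      refine ⟨_, _, List.mem_singleton_self _, ?_⟩
      cases i
      · exact ⟨x + 1, y, by simpa [elt_nil] using credit_mul_b hbc x y, by simpa using hn⟩
      · exact ⟨x, y + 1, credit_mul_b_mul_c hbc x y, by simpa using hn⟩
    | zero => cases he
    | decMid i c =>
      obtain ⟨x, y, rfl, hn⟩ := h
      exact ⟨_, _, List.mem_singleton_self _, x, y, hc' i x y, hn⟩
    | pos => cases he
    | drain t =>
      obtain ⟨x, y, rfl, ht⟩ := h
      by_cases hi : ∃ i, two x y i ≠ 0
      · obtain ⟨i, hi⟩ := hi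
        obtain ⟨x', y', h1, h2⟩ := hb' i x y hi
        refine ⟨[(1, false)], .mid t i, ?_, x', y', h2, fun j hj => ?_⟩
        · rcases t with _ | j
          · cases i <;> simp [Trans, next]
          · have : i ≠ j := fun e => hi (e ▸ ht j rfl)
            obtain rfl : i = !j := by revert this; cases i <;> cases j <;> simp
            simp [Trans, next]
        · rw [h1, Function.update_apply, ht j hj]
          split_ifs with e
          · rw [← e, ht j hj]
          · rfl
      · push Not at hi
        obtain rfl : x = 0 := hi false
        obtain rfl : y = 0 := hi true
        exact ⟨[(0, false)], .pop, by cases t <;> simp [Trans, next], credit_zero_mul_a'⟩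
    | mid t i =>
      obtain ⟨x, y, rfl, ht⟩ := h
      exact ⟨_, _, List.mem_singleton_self _, x, y, hc' i x y, ht⟩
    | pop =>
      obtain rfl := h
      exact ⟨_, _, List.mem_singleton_self _, Γ.elt_cancel 1⟩
    | done =>
      obtain rfl := h
      exact ⟨_, _, List.mem_singleton_self _, one_mul 1⟩
    | fail => exact h.elim
    | fail' => exact h.elim
  all s e h he w s' hT := by
    cases s with
    | zero i c =>
      obtain ⟨x, y, rfl, hi, hn⟩ := h
      simp only [Trans, next, List.mem_cons, Prod.mk.injEq, List.not_mem_nil, or_false] at hT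
      rcases hT with ⟨rfl, rfl⟩ | ⟨rfl, rfl⟩
      · exact ⟨x, y, mul_one _, hn⟩
      · exact ⟨x, y, mul_one _, fun j hj => by cases hj; exact hi⟩
    | pos c =>
      obtain ⟨x, y, rfl, hn⟩ := h
      simp only [Trans, next, List.mem_cons, Prod.mk.injEq, List.not_mem_nil, or_false] at hT
      rcases hT with ⟨rfl, rfl⟩ | ⟨rfl, rfl⟩
      · exact ⟨x, y, mul_one _, hn⟩
      · exact ⟨x, y, mul_one _, fun j hj => by cases hj⟩
    | _ => exact (he rfl).elim

/-! ### The universal player wins if the program halts -/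

section Losing

variable (hΓ : Γ.IsSmall) {X : State → Γ.GraphMonoid → Prop}
  (hX : IsViable Γ Trans IsExists X)
include hX

theorem step_of_singleton {s s' : State} {w : List (Letter (Fin 3))} (hs : next s = [(w, s')])
    (hE : owner s = true) {e : Γ.GraphMonoid} (he : X s e) : X s' (e * Γ.elt w) := by
  obtain ⟨w', s'', hT, h⟩ := hX.ex s e he hE
  rw [Trans, hs, List.mem_singleton, Prod.mk.injEq] at hT
  obtain ⟨rfl, rfl⟩ := hT
  exact h

/-- A letter `b̄` after a pushed entry and an empty top entry is fatal. -/
theorem not_viable_mul_b' {s : State} {e : Γ.GraphMonoid} {L : List (ℕ × ℤ)} {r : ℤ}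
    (h : stack hΓ e = some (L, (0, r))) : ¬X s (e * Γ.elt [(1, false)]) := fun he => by
  refine stack_ne_none hΓ (hX.rinv _ _ he) ?_
  rw [stack_mul_elt, h]
  rfl

theorem of_viable_pop {e : Γ.GraphMonoid} {L : List (ℕ × ℤ)} {g : ℕ × ℤ}
    (h : stack hΓ e = some (L, g)) (he : X .pop (e * Γ.elt [(0, false)])) : g = 0 := by
  by_contra hg
  refine not_viable_mul_b' hΓ hX (L := g :: L) (r := 0) ?_ (step_of_singleton hX rfl rfl he)
  rw [stack_mul_elt, h]
  exact congrArg some (Stack.flip_of_ne hg)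

/-- The existential player passes the test only if the numbers `p` and `r` of letters `b` and `c` in
the top entry represent counter values `p - r` and `r` that are not negative, and the counter under
test is zero. -/
theorem of_viable_drain {t : Option Bool} {e : Γ.GraphMonoid} {L : List (ℕ × ℤ)} {p : ℕ} {r : ℤ}
    (h : stack hΓ e = some (L, (p, r))) (he : X (.drain t) e) :
    0 ≤ r ∧ r ≤ p ∧ (t = some false → r = p) ∧ (t = some true → r = 0) := by
  induction p generalizing e r with
  | zero =>
    obtain ⟨w, s', hT, h'⟩ := hX.ex _ _ he rfl
    by_cases hw : w = [(0, false)] ∧ s' = .pop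
    · obtain ⟨rfl, rfl⟩ := hw
      have := of_viable_pop hΓ hX h h'
      simp only [Prod.mk_eq_zero] at this
      simp [this.2]
    · have : w = [(1, false)] := by
        rcases t with _ | _ <;> simp [Trans, next] at hT <;> tauto
      subst this
      exact (not_viable_mul_b' hΓ hX h h').elim
  | succ p ih =>
    obtain ⟨w, s', hT, h'⟩ := hX.ex _ _ he rfl
    by_cases hw : w = [(0, false)] ∧ s' = .pop
    · obtain ⟨rfl, rfl⟩ := hw
      have := of_viable_pop hΓ hX h h'
      simp at this
    · obtain ⟨i, rfl, rfl, hi⟩ : ∃ i, w = [(1, false)] ∧ s' = .mid t i ∧ t ≠ some i := by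
        rcases t with _ | j
        · simp only [Trans, next, List.mem_cons, Prod.mk.injEq, List.not_mem_nil, or_false] at hT
          rcases hT with hT | ⟨rfl, rfl⟩ | ⟨rfl, rfl⟩
          · exact (hw hT).elim
          · exact ⟨_, rfl, rfl, by simp⟩
          · exact ⟨_, rfl, rfl, by simp⟩
        · simp only [Trans, next, List.mem_cons, Prod.mk.injEq, List.not_mem_nil, or_false] at hT
          rcases hT with hT | ⟨rfl, rfl⟩
          · exact (hw hT).elim
          · exact ⟨_, rfl, rfl, by simp⟩
      have h1 : stack hΓ (e * Γ.elt [(1, false)]) = some (L, (p, r)) := by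
        rw [stack_mul_elt, h]; rfl
      have h2 := step_of_singleton hX rfl rfl h'
      cases i with
      | false =>
        have := ih (r := r) (by simpa [elt_nil] using h1) h2
        refine ⟨this.1, by push_cast; omega, fun e => (hi e).elim, this.2.2.2⟩
      | true =>
        have := ih (r := r - 1) (by rw [cond_true, stack_mul_elt, h1]; rfl) h2
        refine ⟨by omega, by push_cast; omega, fun e => ?_, fun e => (hi e).elim⟩
        have := this.2.2.1 e
        push_cast
        omega

/-- Along a halting computation, the universal player tests every claim of the existential player.
Wrong claims do not survive, so the existential player has to follow the computation until it
halts and she loses. -/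
theorem not_halts_of_viable {t : ℕ} {c : Ctl Bool} {e : Γ.GraphMonoid} {L : List (ℕ × ℤ)}
    {x y : ℕ}
    (h : stack hΓ e = some (L, (x + y, (y : ℤ)))) (he : X (.run c) e) : ¬Halts t c (two x y) := by
  induction t generalizing c e x y with
  | zero => exact fun h => h
  | succ t ih =>
    have h1 := stack_mul_elt hΓ e
    rw [Halts]
    cases hins : instr c with
    | halt =>
      have h2 := step_of_singleton hX (s := .run c) (w := [(1, true)]) (s' := .fail)
        (by simp only [next, hins]) rfl he
      have h3 := step_of_singleton hX (s := .fail) rfl rfl h2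
      have h4 := step_of_singleton hX (s := .fail') rfl rfl h3
      -- the letter `b` ensures that the top entry is nonempty, so that `a` pushes a new one
      refine (not_viable_mul_b' hΓ hX (L := (x + y + 1, (y : ℤ)) :: L) (r := 0) ?_ h4).elim
      rw [stack_mul_elt, h1, h]
      exact congrArg some (Stack.flip_of_ne (by simp))
    | nop c' =>
      have h2 := step_of_singleton hX (s := .run c) (w := []) (s' := .run c')
        (by simp only [next, hins]) rfl he
      exact ih (by simpa [elt_nil] using h) h2
    | inc i c' =>
      have h2 := step_of_singleton hX (s := .run c) (w := [(1, true)]) (s' := .incMid i c')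
        (by simp only [next, hins]) rfl he
      have h3 := step_of_singleton hX (s := .incMid i c') rfl rfl h2
      have h4 : stack hΓ (e * Γ.elt [(1, true)]) = some (L, (x + y + 1, (y : ℤ))) := by
        rw [h1, h]; rfl
      cases i with
      | false =>
        simp only [two_false, update_two_false]
        refine ih ?_ h3
        rw [cond_false, elt_nil, mul_one, h4, Nat.add_right_comm]
      | true =>
        simp only [two_true, update_two_true]
        refine ih ?_ h3
        rw [cond_true, stack_mul_elt, h4]
        rfl
    | dec i c₀ c₁ =>
      obtain ⟨w, s', hT, h'⟩ := hX.ex _ _ he rfl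
      simp only [Trans, next, hins, List.mem_cons, Prod.mk.injEq, List.not_mem_nil,
        or_false] at hT
      rcases hT with ⟨rfl, rfl⟩ | ⟨rfl, rfl⟩
      · rw [elt_nil, mul_one] at h'
        have h2 := hX.all _ _ h' (by simp [IsExists, owner]) [] (.run c₀) (by simp [Trans, next])
        have h3 := hX.all _ _ h' (by simp [IsExists, owner]) [] (.drain (some i))
          (by simp [Trans, next])
        rw [elt_nil, mul_one] at h2 h3
        have h4 := of_viable_drain hΓ hX h h3
        have h5 : two x y i = 0 := by
          cases i with
          | false => have := h4.2.2.1 rfl; push_cast at this; simp only [two_false]; omega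
          | true => have := h4.2.2.2 rfl; simp only [two_true]; omega
        simp only [h5, if_true]
        exact ih h h2
      · have h2 := step_of_singleton hX (s := .decMid i c₁) rfl rfl h'
        have h3 := hX.all _ _ h2 (by simp [IsExists, owner]) [] (.run c₁) (by simp [Trans, next])
        have h4 := hX.all _ _ h2 (by simp [IsExists, owner]) [] (.drain none)
          (by simp [Trans, next])
        rw [elt_nil, mul_one] at h3 h4
        obtain ⟨n, hn⟩ : ∃ n, x + y = n + 1 := by
          rcases Nat.eq_zero_or_eq_succ_pred (x + y) with h0 | h0
          · rw [h0] at h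
            exact (not_viable_mul_b' hΓ hX h h').elim
          · exact ⟨_, h0⟩
        have h5 : stack hΓ (e * Γ.elt [(1, false)]) = some (L, (n, (y : ℤ))) := by
          rw [h1, h, hn]; rfl
        cases i with
        | false =>
          rw [cond_false, elt_nil, mul_one] at h3 h4
          have h6 := (of_viable_drain hΓ hX h5 h4).2.1
          simp only [two_false, update_two_false]
          rw [if_neg (by omega)]
          exact ih (by rw [h5, show x - 1 + y = n by omega]) h3
        | true =>
          have h7 : stack hΓ (e * Γ.elt [(1, false)] * Γ.elt [(2, false)]) =
              some (L, (n, (y : ℤ) - 1)) := by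
            rw [stack_mul_elt, h5]; rfl
          have h6 := (of_viable_drain hΓ hX h7 h4).1
          simp only [two_true, update_two_true]
          rw [if_neg (by omega)]
          exact ih (by rw [cond_true, h7, show x + (y - 1) = n by omega,
            show ((y - 1 : ℕ) : ℤ) = y - 1 by omega]) h3

end Losing

end CounterGame

namespace CounterGame

open ValenceGraph Prog

/-! ### The game as a finite arena -/

theorem Trans.unique {s s' : State} {w w' : List (Letter (Fin 3))} (h : Trans s w s')
    (h' : Trans s w' s') : w = w' := by
  unfold Trans next at *
  grind

theorem Trans.length_le {s s' : State} {w : List (Letter (Fin 3))} (h : Trans s w s') :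
    w.length ≤ 1 := by
  unfold Trans next at *
  grind

theorem exists_trans (s : State) : ∃ w s', Trans s w s' := by
  have : next s ≠ [] := by
    unfold next
    grind
  obtain ⟨⟨w, s'⟩, h⟩ := List.exists_mem_of_ne_nil _ this
  exact ⟨w, s', h⟩

/-- The states of the game whose control points lie in `P`. -/
def part (P : Set (Ctl Bool)) : Set State := {s | match s with
  | .run c => c ∈ P
  | .incMid _ c => c ∈ P
  | .zero _ c => c ∈ P
  | .decMid _ c => c ∈ P
  | .pos c => c ∈ P
  | _ => True}

theorem finite_part {P : Set (Ctl Bool)} (hP : P.Finite) : (part P).Finite := by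
  refine Set.Finite.subset ((((((((hP.image State.run).union
    (.image2 State.incMid Set.finite_univ hP)).union
    (.image2 State.zero Set.finite_univ hP)).union (.image2 State.decMid Set.finite_univ hP)).union
    (hP.image State.pos)).union (Set.finite_range State.drain)).union
    (.image2 State.mid Set.finite_univ Set.finite_univ)).union
    (Set.toFinite {.pop, .done, .fail, .fail'})) fun s hs => ?_
  rcases s with c | ⟨_ | _, c⟩ | ⟨_ | _, c⟩ | ⟨_ | _, c⟩ | c | t | ⟨t, i⟩ | _ <;>
    simp_all [part]

theorem part_closed {P : Set (Ctl Bool)} (hP : ∀ c ∈ P, ∀ c' ∈ (instr c).targets, c' ∈ P)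
    {s : State} (hs : s ∈ part P) {w : List (Letter (Fin 3))} {s' : State} (hT : Trans s w s') :
    s' ∈ part P := by
  unfold Trans at hT
  cases s with
  | run c =>
    have := hP c hs
    simp only [next] at hT
    cases hc : instr c <;> rw [hc] at hT this <;> simp [Instr.targets] at hT this
    · rw [hT.2]; trivial
    · rw [hT.2]; exact this
    · rw [hT.2]; exact this
    · rcases hT with hT | hT <;> rw [hT.2]
      exacts [this.1, this.2]
  | drain t =>
    cases t <;> simp [next] at hT
    · rcases hT with hT | hT | hT <;> rw [hT.2] <;> trivial
    · rcases hT with hT | hT <;> rw [hT.2] <;> trivial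
  | zero i c =>
    simp [next] at hT
    rcases hT with hT | hT <;> rw [hT.2]
    exacts [hs, trivial]
  | pos c =>
    simp [next] at hT
    rcases hT with hT | hT <;> rw [hT.2]
    exacts [hs, trivial]
  | _ =>
    simp [next] at hT
    rw [hT.2]
    trivial

/-- A finite closed part of the game is encoded by lists, where the states are numbered by `ν`. -/
theorem exists_encoding {W : Set State} (hW : W.Finite) :
    ∃ (own : List Bool) (tr : List (ℕ × List (Letter (Fin 3)) × ℕ)) (ν : State → ℕ),
      Set.InjOn ν W ∧ (∀ s ∈ W, own[ν s]? = some (owner s)) ∧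
      (∀ q < own.length, ∃ s ∈ W, ν s = q) ∧
      ∀ p w q, (p, w, q) ∈ tr ↔ ∃ s ∈ W, ∃ s', Trans s w s' ∧ p = ν s ∧ q = ν s' := by
  classical
  have hl : ∀ s, s ∈ hW.toFinset.toList ↔ s ∈ W := by simp
  have hnd := hW.toFinset.nodup_toList
  set l := hW.toFinset.toList
  refine ⟨l.map owner, l.flatMap fun s => (next s).map fun t => (l.idxOf s, t.1, l.idxOf t.2),
    l.idxOf, ?_, ?_, ?_, ?_⟩
  · intro s hs s' hs' h
    exact (List.idxOf_inj ((hl s).2 hs)).1 h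
  · intro s hs
    rw [List.getElem?_map, List.getElem?_idxOf ((hl s).2 hs)]
    rfl
  · intro q hq
    rw [List.length_map] at hq
    exact ⟨l[q], (hl _).1 (List.getElem_mem hq), hnd.idxOf_getElem q hq⟩
  · intro p w q
    simp only [List.mem_flatMap, List.mem_map, hl, Prod.mk.injEq, Trans, Prod.exists]
    constructor
    · rintro ⟨s, hs, w', s', h, rfl, rfl, rfl⟩
      exact ⟨s, hs, s', h, rfl, rfl⟩
    · rintro ⟨s, hs, s', h, rfl, rfl⟩
      exact ⟨s, hs, w, s', h, rfl, rfl, rfl⟩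

/-- The arena given by the lists `own` and `tr`, preceded by a path to the state `start` that is
labelled by the word `b a b ^ N`. -/
def withInput (own : List Bool) (tr : List (ℕ × List (Letter (Fin 3)) × ℕ)) (start N : ℕ) :
    Arena (Fin 3) where
  owner := own ++ (List.range (N + 3)).map fun _ => true
  trans := tr ++ ((List.range N).map fun k =>
      (own.length + k + 1, [((1, true) : Letter (Fin 3))], own.length + k)) ++
    [(own.length, [], start), (own.length + N + 1, [(0, true)], own.length + N),
      (own.length + N + 2, [(1, true)], own.length + N + 1)]
  init := own.length + N + 2

theorem primrec_withInput (own : List Bool) (tr : List (ℕ × List (Letter (Fin 3)) × ℕ))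
    (start : ℕ) : Primrec (withInput own tr start) := by
  have h : Primrec fun N : ℕ => ((withInput own tr start N).owner,
      (withInput own tr start N).trans, (withInput own tr start N).init) := by
    have hadd : ∀ k, Primrec fun N : ℕ => own.length + N + k := fun k =>
      Primrec.nat_add.comp (Primrec.nat_add.comp (.const _) .id) (.const k)
    refine .pair ?_ (.pair ?_ (hadd 2))
    · exact Primrec.list_append.comp (.const own) (Primrec.list_map
        (Primrec.list_range.comp (Primrec.nat_add.comp .id (.const 3))) (Primrec.const true).to₂)
    · refine Primrec.list_append.comp (Primrec.list_append.comp (.const tr)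
        (Primrec.list_map Primrec.list_range ?_)) ?_
      · exact ((hadd 1).comp Primrec.snd).pair
          ((Primrec.const _).pair ((hadd 0).comp Primrec.snd))
      · refine Primrec.list_cons.comp (.const _) (Primrec.list_cons.comp
          ((hadd 1).pair ((Primrec.const _).pair (hadd 0))) (Primrec.list_cons.comp
          ((hadd 2).pair ((Primrec.const _).pair (hadd 1))) (.const [])))
  exact Primrec.of_equiv_symm.comp h

theorem mem_trans_withInput {own : List Bool} {tr : List (ℕ × List (Letter (Fin 3)) × ℕ)}
    {start N p q : ℕ} {w : List (Letter (Fin 3))} :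
    (p, w, q) ∈ (withInput own tr start N).trans ↔
      (p, w, q) ∈ tr ∨
      (∃ k < N, p = own.length + k + 1 ∧ w = [(1, true)] ∧ q = own.length + k) ∨
      (p = own.length ∧ w = [] ∧ q = start) ∨
      (p = own.length + N + 1 ∧ w = [(0, true)] ∧ q = own.length + N) ∨
      (p = own.length + N + 2 ∧ w = [(1, true)] ∧ q = own.length + N + 1) := by
  simp [withInput, eq_comm]

/-- For every program `p` there is an effectively constructible family of arenas such that the
following holds. If `p` does not halt on the counter values `N` and `0`, then the existential player
wins in the `N`-th arena with empty credit; if it halts, then she does not win with any credit. -/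
theorem exists_arenas (p : Prog Bool) : ∃ F : ℕ → Arena (Fin 3), Primrec F ∧
    ∀ N, (F N).IsArena ∧ (F N).LetterLabelled ∧
      ∀ Γ : ValenceGraph (Fin 3), Γ.IsSmall → s(1, 2) ∈ Γ.edges →
        ((∀ t, ¬Halts t (p, []) (two N 0)) → (F N).ExistsWins Γ (F N).init 1) ∧
        ∀ x, (F N).ExistsWins Γ (F N).init x → ∀ t, ¬Halts t (p, []) (two N 0) := by
  have hP : ∀ c ∈ points p [], ∀ c' ∈ (instr c).targets, c' ∈ points p [] := fun c hc => by
    rcases targets_mem_points p [] hc with ⟨b, rfl⟩ | h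
    · simp [instr, Instr.targets]
    · exact h
  have hclosed : ∀ s ∈ part (points p []), ∀ w s', Trans s w s' → s' ∈ part (points p []) :=
    fun s hs w s' hT => part_closed hP hs hT
  have hstart : State.run (p, []) ∈ part (points p []) :=
    self_mem_points p []
  obtain ⟨own, tr, ν, hinj, hown, hsurj, htr⟩ := exists_encoding (finite_part (finite_points p []))
  set W := part (points p [])
  have hlt : ∀ s ∈ W, ν s < own.length := fun s hs => (List.getElem?_eq_some_iff.1 (hown s hs)).1
  have htr_lt : ∀ p w q, (p, w, q) ∈ tr → p < own.length ∧ q < own.length := by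
    intro p w q h
    obtain ⟨s, hs, s', hT, rfl, rfl⟩ := (htr p w q).1 h
    exact ⟨hlt s hs, hlt s' (hclosed s hs _ _ hT)⟩
  refine ⟨withInput own tr (ν (.run (p, []))), primrec_withInput _ _ _, fun N => ?_⟩
  set A := withInput own tr (ν (.run (p, []))) N
  have hmem : ∀ q w q', A.Trans q w q' ↔ _ := fun _ _ _ => mem_trans_withInput
  have hlen : A.owner.length = own.length + (N + 3) := by simp [A, withInput]
  have hs0 := hlt _ hstart
  have hA : A.IsArena := by
    refine ⟨?_, ?_, ?_, ?_⟩
    · rw [hlen]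
      change own.length + N + 2 < _
      omega
    · intro q w q' h
      rw [hlen]
      rcases (hmem q w q').1 h with h | ⟨k, hk, rfl, -, rfl⟩ | ⟨rfl, -, rfl⟩ | ⟨rfl, -, rfl⟩ |
        ⟨rfl, -, rfl⟩
      · have := htr_lt _ _ _ h
        omega
      all_goals omega
    · intro q hq
      rw [hlen] at hq
      rcases lt_trichotomy q own.length with h | rfl | h
      · obtain ⟨s, hs, rfl⟩ := hsurj q h
        obtain ⟨w, s', hT⟩ := exists_trans s
        exact ⟨w, ν s', (hmem _ _ _).2 (Or.inl ((htr _ _ _).2 ⟨s, hs, s', hT, rfl, rfl⟩))⟩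
      · exact ⟨_, _, (hmem _ _ _).2 (Or.inr (Or.inr (Or.inl ⟨rfl, rfl, rfl⟩)))⟩
      · obtain ⟨k, rfl⟩ := Nat.exists_eq_add_of_lt h
        rcases lt_trichotomy k N with h | rfl | h
        · exact ⟨_, _, (hmem _ _ _).2 (Or.inr (Or.inl ⟨k, h, rfl, rfl, rfl⟩))⟩
        · exact ⟨_, _, (hmem _ _ _).2 (Or.inr (Or.inr (Or.inr (Or.inl ⟨rfl, rfl, rfl⟩))))⟩
        · obtain rfl : k = N + 1 := by omega
          exact ⟨_, _, (hmem _ _ _).2 (Or.inr (Or.inr (Or.inr (Or.inr ⟨rfl, rfl, rfl⟩))))⟩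
    · intro q w w' q' h h'
      rcases (hmem _ _ _).1 h with h | ⟨k, hk, hq, hw, -⟩ | ⟨hq, hw, -⟩ | ⟨hq, hw, -⟩ | ⟨hq, hw, -⟩
      · have h0 := htr_lt _ _ _ h
        rcases (hmem _ _ _).1 h' with h' | ⟨k, hk, hq, hw, -⟩ | ⟨hq, hw, -⟩ | ⟨hq, hw, -⟩ |
          ⟨hq, hw, -⟩
        · obtain ⟨s, hs, s', hT, rfl, rfl⟩ := (htr _ _ _).1 h
          obtain ⟨u, hu, u', hT', e, e'⟩ := (htr _ _ _).1 h'
          obtain rfl := hinj hs hu e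
          obtain rfl := hinj (hclosed _ hs _ _ hT) (hclosed _ hs _ _ hT') e'
          exact hT.unique hT'
        all_goals omega
      all_goals
        rcases (hmem _ _ _).1 h' with h' | ⟨k', hk', hq', hw', -⟩ | ⟨hq', hw', -⟩ | ⟨hq', hw', -⟩ |
          ⟨hq', hw', -⟩
        · have h0 := htr_lt _ _ _ h'
          omega
        all_goals first | omega | rw [hw, hw']
  refine ⟨hA, ?_, fun Γ hΓ hbc => ?_⟩
  · intro q w q' h
    rcases (hmem _ _ _).1 h with h | ⟨_, _, _, rfl, _⟩ | ⟨_, rfl, _⟩ | ⟨_, rfl, _⟩ | ⟨_, rfl, _⟩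
    · obtain ⟨s, -, s', hT, -⟩ := (htr _ _ _).1 h
      exact hT.length_le
    all_goals simp
  -- from the states of the path, every move is forced
  have hpath : ∀ k ≤ N, ∀ x : Γ.GraphMonoid,
      (Viable Γ A.Trans A.IsExists (own.length + k) x →
        Viable Γ A.Trans A.IsExists (ν (.run (p, []))) (x * Γ.elt [(1, true)] ^ k)) ∧
      (x ∈ Γ.RInv → Viable Γ A.Trans A.IsExists (ν (.run (p, []))) (x * Γ.elt [(1, true)] ^ k) →
        Viable Γ A.Trans A.IsExists (own.length + k) x) := by
    intro k
    induction k with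
    | zero =>
      intro _ x
      have := Arena.viable_iff_of_forall_trans (A := A) (p := own.length) (w := [])
        (p' := ν (.run (p, []))) (Γ := Γ) (fun v q => by
          rw [hmem]
          constructor
          · rintro (h | ⟨k, hk, h, -⟩ | ⟨-, h⟩ | ⟨h, -⟩ | ⟨h, -⟩)
            · have := htr_lt _ _ _ h
              omega
            · omega
            · exact h
            · omega
            · omega
          · exact fun h => Or.inr (Or.inr (Or.inl ⟨rfl, h⟩))) x
      rw [elt_nil, mul_one] at this
      rw [Nat.add_zero, pow_zero, mul_one]
      exact ⟨fun h => (this.1 h).2, fun hx h => this.2 ⟨hx, h⟩⟩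
    | succ k ih =>
      intro hk x
      have := Arena.viable_iff_of_forall_trans (A := A) (p := own.length + (k + 1))
        (w := [(1, true)]) (p' := own.length + k) (Γ := Γ) (fun v q => by
          rw [hmem]
          constructor
          · rintro (h | ⟨k', hk', h, h'⟩ | ⟨h, -⟩ | ⟨h, -⟩ | ⟨h, -⟩)
            · have := htr_lt _ _ _ h
              omega
            · obtain rfl : k = k' := by omega
              exact h'
            all_goals omega
          · exact fun h => Or.inr (Or.inl ⟨k, hk, rfl, h⟩)) x
      rw [this, pow_succ', ← mul_assoc]
      have ih := ih (by omega) (x * Γ.elt [(1, true)])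
      exact ⟨fun h => ih.1 h.2, fun hx h => ⟨hx, ih.2
        (Γ.rInvSubmonoid.mul_mem hx (elt_mem_rInvSubmonoid _ _)) h⟩⟩
  have hpush : ∀ x : Γ.GraphMonoid, Viable Γ A.Trans A.IsExists (own.length + N + 1) x ↔
      x ∈ Γ.RInv ∧ Viable Γ A.Trans A.IsExists (own.length + N) (x * Γ.elt [(0, true)]) :=
    Arena.viable_iff_of_forall_trans fun v q => by
      rw [hmem]
      constructor
      · rintro (h | ⟨k', hk', h, h'⟩ | ⟨h, -⟩ | ⟨-, h⟩ | ⟨h, -⟩)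
        · have := htr_lt _ _ _ h
          omega
        · omega
        · omega
        · exact h
        · omega
      · exact fun h => Or.inr (Or.inr (Or.inr (Or.inl ⟨rfl, h⟩)))
  have hinit : ∀ x : Γ.GraphMonoid, Viable Γ A.Trans A.IsExists A.init x ↔
      x ∈ Γ.RInv ∧ Viable Γ A.Trans A.IsExists (own.length + N + 1) (x * Γ.elt [(1, true)]) :=
    Arena.viable_iff_of_forall_trans fun v q => by
      rw [hmem]
      change _ ∨ _ ∨ (own.length + N + 2 = _ ∧ _) ∨ (own.length + N + 2 = _ ∧ _) ∨ _ ↔ _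
      constructor
      · rintro (h | ⟨k', hk', h, h'⟩ | ⟨h, -⟩ | ⟨h, -⟩ | ⟨-, h⟩)
        · have h1 := (htr_lt _ _ _ h).1
          change own.length + N + 2 < _ at h1
          omega
        · change own.length + N + 2 = _ at h
          omega
        · omega
        · omega
        · exact h
      · exact fun h => Or.inr (Or.inr (Or.inr (Or.inr ⟨rfl, h⟩)))
  have hgame : ∀ x : Γ.GraphMonoid, Viable Γ A.Trans A.IsExists (ν (.run (p, []))) x ↔
      Viable Γ Trans IsExists (.run (p, [])) x :=
    Arena.viable_embedding ν hclosed (fun s hs => by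
        have h1 : A.owner[ν s]? = own[ν s]? := List.getElem?_append_left (hlt s hs)
        rw [Arena.IsExists, h1, hown s hs, Option.some_inj, IsExists])
      (fun s hs w q => by
        rw [hmem]
        constructor
        · rintro (h | ⟨k', hk', h, h'⟩ | ⟨h, -⟩ | ⟨h, -⟩ | ⟨h, -⟩)
          · obtain ⟨u, hu, s', hT, e, rfl⟩ := (htr _ _ _).1 h
            obtain rfl := hinj hs hu e
            exact ⟨s', hT, rfl⟩
          all_goals
            have := hlt s hs
            omega
        · rintro ⟨s', hT, rfl⟩
          exact Or.inl ((htr _ _ _).2 ⟨s, hs, s', hT, rfl, rfl⟩)) hstart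
  constructor
  · intro hn
    rw [Arena.existsWins_iff_viable hA hA.init_lt, hinit, hpush]
    have h1 := elt_mem_rInvSubmonoid Γ
    rw [one_mul]
    refine ⟨one_mem Γ.rInvSubmonoid, h1 1, (hpath N le_rfl _).2 (mul_mem (h1 1) (h1 0)) ?_⟩
    rw [hgame]
    exact ⟨_, isViable_honest hbc, N, 0, by simp [credit], hn⟩
  · intro x hx t
    rw [Arena.existsWins_iff_viable hA hA.init_lt, hinit, hpush] at hx
    obtain ⟨hx, -, h⟩ := hx
    obtain ⟨X, hX, h⟩ := (hgame _).1 ((hpath N le_rfl _).1 h)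
    -- the letter `b` makes the top entry nonempty, so that the letter `a` pushes a new entry
    obtain ⟨⟨L, n, z⟩, hS⟩ := Option.ne_none_iff_exists'.1 (stack_ne_none hΓ hx)
    have h1 : ∀ k, stack hΓ (x * Γ.elt [(1, true)] * Γ.elt [(0, true)] * Γ.elt [(1, true)] ^ k) =
        some ((n + 1, z) :: L, (k, 0)) := by
      intro k
      induction k with
      | zero =>
        rw [pow_zero, mul_one, stack_mul_elt, stack_mul_elt, hS]
        exact congrArg some (Stack.flip_of_ne (by simp))
      | succ k ih =>
        rw [pow_succ, ← mul_assoc, stack_mul_elt, ih]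
        rfl
    exact not_halts_of_viable hΓ hX (h1 N) h

end CounterGame

/-! ### Undecidability -/

/-- Both problems are undecidable over every graph in which `b` has no self-loop, `b` and `c` are
adjacent, and `a` is adjacent to no other vertex. -/
theorem undecidable_of_isSmall {Γ : ValenceGraph (Fin 3)} (hΓ : Γ.IsSmall)
    (hbc : s(1, 2) ∈ Γ.edges) {K : Set (Arena (Fin 3))} (hK : {A | A.LetterLabelled} ⊆ K) :
    ¬FVDecidable Γ K ∧ ¬UVDecidable Γ K := by
  obtain ⟨p, hp⟩ := Prog.exists_universal_prog
  obtain ⟨F, hF, hFp⟩ := CounterGame.exists_arenas p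
  have hpow : Primrec fun n : ℕ => 2 ^ n :=
    (Primrec.nat_rec₁ 1 (Primrec.nat_mul.comp .snd (.const 2)).to₂).of_eq fun n => by
      induction n with
      | zero => rfl
      | succ n ih => rw [pow_succ, ← ih]
  have hG : Computable fun c : Nat.Partrec.Code => F (2 ^ Encodable.encode c) :=
    (hF.comp (hpow.comp Primrec.encode)).to_comp
  -- a decision procedure for the complement of the halting problem is impossible
  have key : ∀ f : Nat.Partrec.Code → Bool, Computable f →
      ¬∀ c, f c = true ↔ ¬(c.eval 0).Dom := by
    intro f hf h
    refine ComputablePred.halting_problem 0 (ComputablePred.computable_iff.2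
      ⟨fun c => !f c, Primrec.not.to_comp.comp hf, ?_⟩)
    funext c
    have := h c
    cases hc : f c <;> simp_all
  have hdom : ∀ c : Nat.Partrec.Code, (¬(c.eval 0).Dom) ↔
      ∀ t, ¬Prog.Halts t (p, []) (Prog.two (2 ^ Encodable.encode c) 0) := fun c => by
    rw [← hp c, not_exists]
  constructor
  · rintro ⟨f, hf, h⟩
    refine key (fun c => f (F (2 ^ Encodable.encode c), [])) (hf.comp (hG.pair (.const _)))
      fun c => ?_
    obtain ⟨hA, hL, hw⟩ := hFp (2 ^ Encodable.encode c)
    rw [h _ _ hA (hK hL), hdom]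
    exact ⟨(hw Γ hΓ hbc).2 _, (hw Γ hΓ hbc).1⟩
  · rintro ⟨f, hf, h⟩
    refine key (fun c => f (F (2 ^ Encodable.encode c))) (hf.comp hG) fun c => ?_
    obtain ⟨hA, hL, hw⟩ := hFp (2 ^ Encodable.encode c)
    rw [h _ hA (hK hL), hdom]
    exact ⟨fun ⟨_, hx⟩ => (hw Γ hΓ hbc).2 _ hx, fun hn => ⟨[], (hw Γ hΓ hbc).1 hn⟩⟩

theorem mainTheorem4 (aLoop : Bool) (Γ : ValenceGraph (Fin 3))
    (hΓ : Γ = graphI aLoop ∨ Γ = graphII aLoop) :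
    (¬ FVDecidable Γ Set.univ ∧ ¬ UVDecidable Γ Set.univ) ∧
      (¬ FVDecidable Γ {A | A.LetterLabelled} ∧ ¬ UVDecidable Γ {A | A.LetterLabelled}) := by
  have hsmall : Γ.IsSmall := by
    rcases hΓ with rfl | rfl
    · rintro e ((rfl | rfl) | ⟨-, rfl⟩) <;> simp
    · rintro e (rfl | ⟨-, rfl⟩) <;> simp
  have hbc : s(1, 2) ∈ Γ.edges := by
    rcases hΓ with rfl | rfl <;> simp [graphI, graphII]
  exact ⟨undecidable_of_isSmall hsmall hbc (Set.subset_univ _),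
    undecidable_of_isSmall hsmall hbc le_rfl⟩
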